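/- **Conventions.** All model spaces have underlying space $\mathbb{R}^3=\mathbb{R}\times\mathbb{C}$ with cylindrical coordinates. For $\alpha>0$, $\mathbb{E}^{1,2}_\alpha$ carries the flat Lorentzian metric $-dt^2+dr^2+\left(\frac{\alpha}{2\pi}\right)^2r^2d\theta^2$ (massive particle of cone angle $\alpha$) and $\mathbb{E}^{1,2}_0$ carries $-2\,d\tau\,dr+dr^2+r^2d\theta^2$ (BTZ model). The singular locus is the axis $\{r=0\}$, except that $\mathbb{E}^{1,2}_{2\pi}$ is Minkowski space and has no singular point; the regular locus is its complement. A nonzero causal vector at a regular point is future if its first component ($dt$, resp. $d\tau$) is positive. Let $A\subset\mathbb{R}_+$. An $\mathbb{E}^{1,2}_A$-manifold is a second countable Hausdorff space $M$ with an atlas of homeomorphisms from open subsets of $M$ onto open subsets of the spaces $\mathbb{E}^{1,2}_\alpha$, $\alpha\in A$, whose transition maps send regular points to regular points and are there local isometries preserving orientation and time orientation. $\mathrm{Reg}(M)$ is the set of points that charts send to regular points; the other points are singular. A future causal curve is a continuous curve along which the first chart coordinate is locally strictly increasing and whose velocity, at all but countably many of the times when the curve is in $\mathrm{Reg}(M)$,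 is a future causal vector; it is inextendible if it converges to a point of $M$ neither in the future nor in the past. A Cauchy surface is a topological surface $\Sigma\subset M$ that every inextendible causal curve meets exactly once ($M$ is globally hyperbolic if it has one). It is piecewise smooth and spacelike if $\mathrm{Reg}(\Sigma):=\Sigma\cap \mathrm{Reg}(M)$ admits, around each of its points, a homeomorphic parametrization by an open subset of $\mathbb{R}^2$ covered by finitely many closed nondegenerate triangles, on each of which the parametrization is smooth up to the boundary with injective differential and spacelike image planes. For $x,y\in\mathrm{Reg}(\Sigma)$ let $d(x,y)\in[0,\infty]$ be the Riemannian distance: the infimum of the lengths $\int\sqrt{ds^2(\gamma'(s))}\,ds$ of the piecewise $C^1$ curves $\gamma$ in $\mathrm{Reg}(\Sigma)$ from $x$ to $y$ ($\infty$ if there is no such curve). **Proposition.** Let $M$ be a globally hyperbolic $\mathbb{E}^{1,2}_A$-manifold and $\Sigma$ a piecewise smooth spacelike Cauchy surface of $M$. Then $d$ extends continuously to all of $\Sigma\times\Sigma$, including the singular points: there is a unique continuous function $D:\Sigma\times\Sigma\to[0,\infty]$ (where $[0,\infty]$ has its usual topology) with $D=d$ on $\mathrm{Reg}(\Sigma)\times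 \mathrm{Reg}(\Sigma)$. Moreover $D(p,q)<\infty$ whenever $p$ and $q$ lie in the same connected component of $\Sigma$; in particular $D$ is real-valued if $\Sigma$ is connected. -/

import Mathlib

open Set Filter Topology MeasureTheory
open scoped ENNReal ContDiff

noncomputable section

namespace SingularFlat

/-! ### The model spaces

All model spaces have underlying space `ℝ × ℂ`. The point `(t, r e^{iθ})` has cylindrical
coordinates `(t, r, θ)`; the first coordinate is the one written `τ` in the BTZ case. -/

/-- The 1-form `dr` at the point `x`, evaluated at the tangent vector `v`. -/
def dr (x v : ℝ × ℂ) : ℝ := (starRingEnd ℂ x.2 * v.2).re / ‖x.2‖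

/-- The 1-form `r dθ` at the point `x`, evaluated at the tangent vector `v`. -/
def rdtheta (x v : ℝ × ℂ) : ℝ := (starRingEnd ℂ x.2 * v.2).im / ‖x.2‖

/-- The flat Lorentzian metric (as a quadratic form on tangent vectors) of the model space with
parameter `α`: the BTZ metric `-2 dτ dr + dr² + r² dθ²` for `α = 0`, and the massive particle
metric `-dt² + dr² + (α / 2π)² r² dθ²` of cone angle `α` for `α ≠ 0`.
The Euclidean part is written with `|dz|² = dr² + r² dθ²` (see `ds2_zero_eq` and `ds2_eq`), so
that for `α = 2π` one gets the Minkowski metric also at the points of the axis `r = 0`. -/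
def ds2 (α : ℝ) (x v : ℝ × ℂ) : ℝ :=
  if α = 0 then -2 * v.1 * dr x v + ‖v.2‖ ^ 2
  else -v.1 ^ 2 + ‖v.2‖ ^ 2 + ((α / (2 * Real.pi)) ^ 2 - 1) * rdtheta x v ^ 2

theorem norm_sq_eq (x v : ℝ × ℂ) (hx : x.2 ≠ 0) :
    ‖v.2‖ ^ 2 = dr x v ^ 2 + rdtheta x v ^ 2 := by
  have h : ‖x.2‖ ≠ 0 := norm_ne_zero_iff.mpr hx
  have h2 : ‖starRingEnd ℂ x.2 * v.2‖ ^ 2 =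
      (starRingEnd ℂ x.2 * v.2).re ^ 2 + (starRingEnd ℂ x.2 * v.2).im ^ 2 := by
    rw [Complex.sq_norm, Complex.normSq_apply]; ring
  rw [norm_mul, RCLike.norm_conj] at h2
  unfold dr rdtheta
  rw [div_pow, div_pow, ← add_div, ← h2]
  field_simp

theorem ds2_zero_eq (x v : ℝ × ℂ) (hx : x.2 ≠ 0) :
    ds2 0 x v = -2 * v.1 * dr x v + dr x v ^ 2 + rdtheta x v ^ 2 := by
  rw [ds2, if_pos rfl, norm_sq_eq x v hx]; ring

theorem ds2_eq (α : ℝ) (hα : α ≠ 0) (x v : ℝ × ℂ) (hx : x.2 ≠ 0) :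
    ds2 α x v = -v.1 ^ 2 + dr x v ^ 2 + (α / (2 * Real.pi)) ^ 2 * rdtheta x v ^ 2 := by
  rw [ds2, if_neg hα, norm_sq_eq x v hx]; ring

/-- The regular locus of the model space with parameter `α`: the complement of the axis `r = 0`,
except that Minkowski space (`α = 2π`) has no singular point. -/
def modelReg (α : ℝ) : Set (ℝ × ℂ) := {x | x.2 ≠ 0 ∨ α = 2 * Real.pi}

/-- `v` is a nonzero future directed causal vector at the (regular) point `x` of the model space
with parameter `α`. Nonzero causal vectors have a nonzero first component, and the future ones are
those with a positive first component. -/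
def FutureCausal (α : ℝ) (x v : ℝ × ℂ) : Prop := ds2 α x v ≤ 0 ∧ 0 < v.1

/-- Near the regular point `x`, the map `Φ` from the model space with parameter `α` to the one with
parameter `β` is a morphism of flat Lorentzian structures: it is smooth and its differential
preserves the Lorentzian metric, the orientation and the time orientation. -/
structure IsFlatMorphismAt (α β : ℝ) (Φ : ℝ × ℂ → ℝ × ℂ) (x : ℝ × ℂ) : Prop where
  smooth : ContDiffAt ℝ ∞ Φ x
  isometric : ∀ v, ds2 β (Φ x) (fderiv ℝ Φ x v) = ds2 α x v
  orientation : 0 < LinearMap.det (fderiv ℝ Φ x : (ℝ × ℂ) →ₗ[ℝ] (ℝ × ℂ))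
  time_orientation : ∀ v, FutureCausal α x v → FutureCausal β (Φ x) (fderiv ℝ Φ x v)

/-! ### Singular flat spacetimes -/

/-- An atlas that makes `M` a singular flat spacetime with parameters in `A`. A chart is a pair
`(α, e)` where `e` is a homeomorphism from an open subset of `M` onto an open subset of the model
space with parameter `α`. Changes of charts send regular points to regular points and are morphisms
of flat Lorentzian structures there (nothing but continuity is required at singular points). -/
structure Atlas (A : Set ℝ) (M : Type*) [TopologicalSpace M] where
  charts : Set (ℝ × OpenPartialHomeomorph M (ℝ × ℂ))
  param_mem : ∀ φ ∈ charts, φ.1 ∈ A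
  cover : ∀ x : M, ∃ φ ∈ charts, x ∈ φ.2.source
  reg_to_reg : ∀ φ ∈ charts, ∀ ψ ∈ charts, ∀ x ∈ φ.2.source ∩ ψ.2.source,
    φ.2 x ∈ modelReg φ.1 → ψ.2 x ∈ modelReg ψ.1
  compatible : ∀ φ ∈ charts, ∀ ψ ∈ charts, ∀ x ∈ φ.2.source ∩ ψ.2.source,
    φ.2 x ∈ modelReg φ.1 → IsFlatMorphismAt φ.1 ψ.1 (ψ.2 ∘ φ.2.symm) (φ.2 x)

namespace Atlas

variable {A : Set ℝ} {M : Type*} [TopologicalSpace M] (𝒜 : Atlas A M)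

/-- A chart around the point `x`. -/
def chartAt (x : M) : ℝ × OpenPartialHomeomorph M (ℝ × ℂ) := (𝒜.cover x).choose

/-- The regular part of the spacetime. -/
def reg : Set M := {x | ∃ φ ∈ 𝒜.charts, x ∈ φ.2.source ∧ φ.2 x ∈ modelReg φ.1}

/-! ### Causal curves and Cauchy surfaces -/

/-- A future causal curve without end points, parametrized by `ℝ`: a continuous curve along which
the first coordinate of charts is locally strictly increasing (this orients the pieces of the curve
that run in the singular lines) and whose velocity at the times spent in the regular part is, up to
countably many exceptional times, a future causal vector. -/
structure IsFutureCausalCurve (c : ℝ → M) : Prop where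
  continuous : Continuous c
  increasing : ∀ s : ℝ, ∃ φ ∈ 𝒜.charts, c s ∈ φ.2.source ∧
    ∃ J ∈ 𝓝 s, StrictMonoOn (fun t => (φ.2 (c t)).1) J
  causal : ∃ E : Set ℝ, E.Countable ∧ ∀ s ∉ E, c s ∈ 𝒜.reg →
    ∃ φ ∈ 𝒜.charts, c s ∈ φ.2.source ∧
      ∃ v, HasDerivAt (fun t => φ.2 (c t)) v s ∧ FutureCausal φ.1 (φ.2 (c s)) v

/-- An inextendible future causal curve: it converges in `M` neither in the future nor in the past.
(An inextendible curve has no first and no last point, so it can be parametrized by `ℝ`.) -/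
structure IsInextendibleCausalCurve (c : ℝ → M) : Prop extends 𝒜.IsFutureCausalCurve c where
  no_future_endpoint : ¬ ∃ p, Tendsto c atTop (𝓝 p)
  no_past_endpoint : ¬ ∃ p, Tendsto c atBot (𝓝 p)

/-- A Cauchy surface: a topological surface that every inextendible causal curve meets exactly
once. -/
structure IsCauchySurface (S : Set M) : Prop where
  surface : Nonempty (ChartedSpace (EuclideanSpace ℝ (Fin 2)) S)
  meets_once : ∀ c : ℝ → M, 𝒜.IsInextendibleCausalCurve c → ∃! s, c s ∈ S

/-- The regular part of `S` is a piecewise smooth spacelike surface: around each of its points, `S`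
has a local parametrization by an open subset of the plane, covered by finitely many closed
(nondegenerate) triangles, which on each triangle is smooth up to the boundary, and whose
differential at each point of each triangle is such that the image of every nonzero vector is
spacelike (in particular it is injective and its image is a spacelike plane). -/
def IsPiecewiseSmoothSpacelike (S : Set M) : Prop :=
  ∀ x : S, (x : M) ∈ 𝒜.reg →
    ∃ φ ∈ 𝒜.charts, ∃ κ : OpenPartialHomeomorph S (EuclideanSpace ℝ (Fin 2)),
      x ∈ κ.source ∧
      (∀ y ∈ κ.source, (y : M) ∈ φ.2.source ∧ φ.2 (y : M) ∈ modelReg φ.1) ∧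
      ∃ 𝒯 : Finset (Affine.Triangle ℝ (EuclideanSpace ℝ (Fin 2))),
        (κ.target ⊆ ⋃ T ∈ 𝒯, convexHull ℝ (range T.points)) ∧
        ∀ T ∈ 𝒯,
          let K := κ.target ∩ convexHull ℝ (range T.points)
          let F : EuclideanSpace ℝ (Fin 2) → ℝ × ℂ := fun u => φ.2 (κ.symm u : M)
          ContDiffOn ℝ ∞ F K ∧
            ∀ u ∈ K, ∀ w ≠ 0, 0 < ds2 φ.1 (F u) (fderivWithin ℝ F K u w)

/-! ### The Riemannian distance on the regular part of a spacelike surface -/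

/-- `γ` restricts on `[0, 1]` to a piecewise `C¹` curve in the regular part of `S`. -/
structure IsPiecewiseC1Curve (S : Set M) (γ : ℝ → M) : Prop where
  continuousOn : ContinuousOn γ (Icc 0 1)
  mem : ∀ s ∈ Icc (0 : ℝ) 1, γ s ∈ S ∩ 𝒜.reg
  piecewise : ∃ (n : ℕ) (t : ℕ → ℝ), Monotone t ∧ t 0 = 0 ∧ t n = 1 ∧
    ∀ i < n, ∀ s ∈ Icc (t i) (t (i + 1)), ∃ φ ∈ 𝒜.charts, γ s ∈ φ.2.source ∧
      ContDiffWithinAt ℝ 1 (fun s' => φ.2 (γ s')) (Icc (t i) (t (i + 1))) s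

/-- The speed `√(ds²(γ'(s)))` of a curve, for the ambient metric read in a chart around `γ s`. -/
def speed (γ : ℝ → M) (s : ℝ) : ℝ :=
  √(ds2 (𝒜.chartAt (γ s)).1 ((𝒜.chartAt (γ s)).2 (γ s))
    (deriv (fun s' => (𝒜.chartAt (γ s)).2 (γ s')) s))

/-- The length of the curve `γ` restricted to `[0, 1]`. -/
def length (γ : ℝ → M) : ℝ≥0∞ := ∫⁻ s in Icc (0 : ℝ) 1, ENNReal.ofReal (𝒜.speed γ s)

/-- The distance on the regular part of `S` induced by the Riemannian metric that the ambient
Lorentzian metric induces there: the infimum of the lengths of the piecewise `C¹` curves in the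
regular part of `S` that join `x` to `y` (so it is `∞` if there is no such curve). -/
def regDist (S : Set M) (x y : M) : ℝ≥0∞ :=
  ⨅ (γ : ℝ → M) (_ : 𝒜.IsPiecewiseC1Curve S γ ∧ γ 0 = x ∧ γ 1 = y), 𝒜.length γ

end Atlas

end SingularFlat

end

/-!
The distance extends because it is small near every point `p` of the surface: for every `ε > 0`
there is a neighborhood of `p` in `S` on whose regular part `d ≤ ε`
(`exists_nhdsWithin_regDist_le`). Together with the triangle inequality and the density of the
regular part this gives the continuous extension (`exists_continuous_extension_of_small`), and being
at finite distance is then an open and closed relation (`ne_top_of_mem_connectedComponent`).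

At a regular point, and more precisely, `d x y` is for `y` near `x` at most twice the Lorentzian
length of the chord `y - x` read in any chart
(`IsPiecewiseSmoothSpacelike.eventually_regDist_le`): near `x`, the two points lie in a common
triangle of a parametrization, where a segment joins them. By continuous induction such an
infinitesimal bound can be integrated along any continuous curve of the regular part
(`IsPiecewiseSmoothSpacelike.regDist_le_of_local`), so that curves need not be adapted to the
triangulation.

At a singular point `p = (t₀, 0)`, the Cauchy property shows that `S` is the graph of a continuous
function `f` over a disc `|z| < ρ` (`IsCauchySurface.exists_continuous_graph`). Indeed `S` is
acausal, hence vertical lines, which are causal, meet it at most once. A curve that comes up the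
axis to `(t₀ - ε / 2, 0)`, goes out to `(·, z)` and then up to `(t₀ + ε / 2, z)` extends to an
inextendible causal curve (`exists_inextendible`), which has to meet `S`. It does not meet `S` in
the part which is in the past of `p`, nor in the part which is in the future of `p`, nor while going
out if `z` is small, since `S` is closed (`IsCauchySurface.isClosed`). Only curves that go away from
the axis are used, since in the BTZ model no causal curve reaches the axis from outside.

Two points near `p` are joined in the graph by a piece of radius and a piece of circle. Circles have
length `O(ρ)`. So have radii in the massive case. In the BTZ case the length of a radius is
`∫ √(1 - 2 f') dr ≤ ∫ (1 - f') dr`, which is `O(ρ)` plus the oscillation of `f`; it is small by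
continuity of `f`, although `f'` need not be bounded.
-/

namespace SingularFlat

/-! ### The metrics of the model spaces -/

theorem dr_smul (x v : ℝ × ℂ) (k : ℝ) : dr x (k • v) = k * dr x v := by
  simp [dr, Complex.mul_re]; ring

theorem rdtheta_smul (x v : ℝ × ℂ) (k : ℝ) : rdtheta x (k • v) = k * rdtheta x v := by
  simp [rdtheta, Complex.mul_im]; ring

theorem ds2_smul (α : ℝ) (x v : ℝ × ℂ) (k : ℝ) : ds2 α x (k • v) = k ^ 2 * ds2 α x v := by
  have hn : ‖(k • v).2‖ ^ 2 = k ^ 2 * ‖v.2‖ ^ 2 := by simp [mul_pow]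
  have h1 : (k • v).1 = k * v.1 := by simp
  unfold ds2
  split_ifs
  · rw [hn, dr_smul, h1]; ring
  · rw [hn, rdtheta_smul, h1]; ring

theorem abs_rdtheta_le (x v : ℝ × ℂ) : |rdtheta x v| ≤ ‖v.2‖ := by
  unfold rdtheta
  rw [abs_div, abs_norm]
  refine div_le_of_le_mul₀ (norm_nonneg _) (norm_nonneg _) ((Complex.abs_im_le_norm _).trans ?_)
  rw [norm_mul, RCLike.norm_conj, mul_comm]

/-- The cylindrical components of a vector at a point off the axis. -/
theorem dr_mul_unit {τ T R : ℝ} (hR : 0 < R) {e : ℂ} (he : ‖e‖ = 1) (w : ℂ) :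
    dr (τ, R * e) (T, w * e) = w.re := by
  have h1 : starRingEnd ℂ e * e = 1 := by
    rw [mul_comm, Complex.mul_conj, Complex.normSq_eq_norm_sq, he]; simp
  have h2 : starRingEnd ℂ (R * e) * (w * e) = R * w := by
    rw [map_mul, Complex.conj_ofReal]
    linear_combination (R * w : ℂ) * h1
  simp only [dr, h2, norm_mul, he, Complex.norm_real, Complex.re_ofReal_mul]
  rw [Real.norm_of_nonneg hR.le]
  field_simp

theorem rdtheta_mul_unit {τ T R : ℝ} (hR : 0 < R) {e : ℂ} (he : ‖e‖ = 1) (w : ℂ) :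
    rdtheta (τ, R * e) (T, w * e) = w.im := by
  have h1 : starRingEnd ℂ e * e = 1 := by
    rw [mul_comm, Complex.mul_conj, Complex.normSq_eq_norm_sq, he]; simp
  have h2 : starRingEnd ℂ (R * e) * (w * e) = R * w := by
    rw [map_mul, Complex.conj_ofReal]
    linear_combination (R * w : ℂ) * h1
  simp only [rdtheta, h2, norm_mul, he, Complex.norm_real, Complex.im_ofReal_mul]
  rw [Real.norm_of_nonneg hR.le]
  field_simp

theorem isOpen_modelReg (α : ℝ) : IsOpen (modelReg α) := by
  by_cases h : α = 2 * Real.pi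
  · simp [modelReg, h]
  · simpa [modelReg, h] using isOpen_ne.preimage (continuous_snd (X := ℝ) (Y := ℂ))

theorem continuousAt_ds2 {α : ℝ} {x : ℝ × ℂ} (hx : x ∈ modelReg α) (v : ℝ × ℂ) :
    ContinuousAt (fun p : (ℝ × ℂ) × (ℝ × ℂ) => ds2 α p.1 p.2) (x, v) := by
  rcases hx with hx | rfl
  · have hn : ‖x.2‖ ≠ 0 := norm_ne_zero_iff.mpr hx
    have h1 : ContinuousAt (fun p : (ℝ × ℂ) × (ℝ × ℂ) => dr p.1 p.2) (x, v) := by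
      unfold dr
      refine ContinuousAt.div (Continuous.continuousAt ?_) (Continuous.continuousAt ?_) hn
      · exact Complex.continuous_re.comp ((Complex.continuous_conj.comp (by fun_prop)).mul
          (by fun_prop))
      · fun_prop
    have h2 : ContinuousAt (fun p : (ℝ × ℂ) × (ℝ × ℂ) => rdtheta p.1 p.2) (x, v) := by
      unfold rdtheta
      refine ContinuousAt.div (Continuous.continuousAt ?_) (Continuous.continuousAt ?_) hn
      · exact Complex.continuous_im.comp ((Complex.continuous_conj.comp (by fun_prop)).mul
          (by fun_prop))
      · fun_prop
    unfold ds2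
    split_ifs
    · fun_prop
    · fun_prop
  · have h1 : (2 * Real.pi / (2 * Real.pi)) = 1 := div_self (by positivity)
    have h2 : 2 * Real.pi ≠ 0 := by positivity
    simp only [ds2, if_neg h2, h1, one_pow, sub_self, zero_mul, add_zero]
    fun_prop

theorem continuousAt_ds2_comp {X : Type*} [TopologicalSpace X] {α : ℝ} {f g : X → ℝ × ℂ} {a : X}
    (hf : ContinuousAt f a) (hg : ContinuousAt g a) (ha : f a ∈ modelReg α) :
    ContinuousAt (fun q => ds2 α (f q) (g q)) a :=
  ContinuousAt.comp (f := fun q => (f q, g q)) (g := fun p : (ℝ × ℂ) × (ℝ × ℂ) => ds2 α p.1 p.2)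
    (continuousAt_ds2 ha (g a)) (hf.prodMk hg)

theorem FutureCausal.smul {α : ℝ} {x v : ℝ × ℂ} (h : FutureCausal α x v) {k : ℝ} (hk : 0 < k) :
    FutureCausal α x (k • v) := by
  refine ⟨?_, by simpa using mul_pos hk h.2⟩
  rw [ds2_smul]
  exact mul_nonpos_of_nonneg_of_nonpos (by positivity) h.1

/-- Vertical lines are causal in all model spaces (they are lightlike in the BTZ case). -/
theorem futureCausal_vertical (α : ℝ) (x : ℝ × ℂ) : FutureCausal α x (1, 0) := by
  refine ⟨?_, by simp⟩
  unfold ds2 dr rdtheta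
  split_ifs <;> simp

/-- Off the axis, a vector with components `dt = 2`, `dr = 1`, `dθ = 0` is timelike in all model
spaces. On the axis of Minkowski space, vertical vectors are. -/
theorem exists_timelike {α : ℝ} {x : ℝ × ℂ} (hreg : x ∈ modelReg α) :
    ∃ v : ℝ × ℂ, ds2 α x v < 0 ∧ 0 < v.1 := by
  by_cases hx : x.2 = 0
  · have hα : α ≠ 0 := by
      rcases hreg with h | rfl
      · exact absurd hx h
      · positivity
    exact ⟨(1, 0), by simp [ds2, hα, rdtheta], by simp⟩
  · have hn : 0 < ‖x.2‖ := norm_pos_iff.mpr hx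
    obtain ⟨e, he, hxe⟩ : ∃ e : ℂ, ‖e‖ = 1 ∧ x = (x.1, ‖x.2‖ * e) :=
      ⟨_, Complex.norm_exp_ofReal_mul_I x.2.arg, by rw [Complex.norm_mul_exp_arg_mul_I]⟩
    have h1 : dr x (2, 1 * e) = 1 := by
      rw [hxe]; exact dr_mul_unit hn he 1
    have h2 : rdtheta x (2, 1 * e) = 0 := by
      rw [hxe]; exact rdtheta_mul_unit hn he 1
    refine ⟨(2, 1 * e), ?_, by simp⟩
    by_cases hα : α = 0
    · subst hα
      rw [ds2_zero_eq _ _ hx, h1, h2]; norm_num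
    · rw [ds2_eq _ hα _ _ hx, h1, h2]; norm_num

/-! ### Concatenation of causal curves -/

namespace Atlas

variable {A : Set ℝ} {M : Type*} [TopologicalSpace M] (𝒜 : Atlas A M)

/-- `c` is a future causal curve on the set of times `I`. In contrast with
`IsFutureCausalCurve`, the first coordinate is required to increase in every chart: this makes the
condition stable under concatenation. -/
structure IsCausalOn (c : ℝ → M) (I : Set ℝ) : Prop where
  continuousOn : ContinuousOn c I
  increasing : ∀ s ∈ I, ∀ φ ∈ 𝒜.charts, c s ∈ φ.2.source →
    ∃ J ∈ 𝓝 s, StrictMonoOn (fun t => (φ.2 (c t)).1) (J ∩ I)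
  causal : ∃ E : Set ℝ, E.Countable ∧ ∀ s ∈ I, s ∉ E → c s ∈ 𝒜.reg →
    ∃ φ ∈ 𝒜.charts, c s ∈ φ.2.source ∧
      ∃ v, HasDerivAt (fun t => φ.2 (c t)) v s ∧ FutureCausal φ.1 (φ.2 (c s)) v

variable {𝒜}

theorem IsCausalOn.mono {c : ℝ → M} {I I' : Set ℝ} (h : 𝒜.IsCausalOn c I) (hI : I' ⊆ I) :
    𝒜.IsCausalOn c I' where
  continuousOn := h.continuousOn.mono hI
  increasing s hs φ hφ hsφ := by
    obtain ⟨J, hJ, hm⟩ := h.increasing s (hI hs) φ hφ hsφ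
    exact ⟨J, hJ, hm.mono (inter_subset_inter_right _ hI)⟩
  causal := by
    obtain ⟨E, hE, hc⟩ := h.causal
    exact ⟨E, hE, fun s hs => hc s (hI hs)⟩

theorem IsCausalOn.comp_affine {c : ℝ → M} {I : Set ℝ} (h : 𝒜.IsCausalOn c I) {k : ℝ}
    (hk : 0 < k) (m : ℝ) :
    𝒜.IsCausalOn (fun s => c (k * s + m)) ((fun s => k * s + m) ⁻¹' I) := by
  have hcont : Continuous (fun s : ℝ => k * s + m) := by fun_prop
  have hmono : StrictMono (fun s : ℝ => k * s + m) := fun a b hab => by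
    have := mul_lt_mul_of_pos_left hab hk
    simpa using this
  refine ⟨h.continuousOn.comp hcont.continuousOn (mapsTo_preimage _ _), ?_, ?_⟩
  · intro s hs φ hφ hsφ
    obtain ⟨J, hJ, hm⟩ := h.increasing _ hs φ hφ hsφ
    exact ⟨_, hcont.continuousAt hJ, fun a ha b hb hab => hm ha hb (hmono hab)⟩
  · obtain ⟨E, hE, hc⟩ := h.causal
    refine ⟨_, hE.preimage hmono.injective, fun s hs hsE hreg => ?_⟩
    obtain ⟨φ, hφ, hsφ, v, hv, hf⟩ := hc _ hs hsE hreg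
    refine ⟨φ, hφ, hsφ, k • v, ?_, hf.smul hk⟩
    have hd : HasDerivAt (fun s : ℝ => k * s + m) k s := by
      simpa using ((hasDerivAt_id s).const_mul k).add_const m
    exact HasDerivAt.scomp s hv hd

theorem IsCausalOn.congr {c c' : ℝ → M} {a b : ℝ} (h : 𝒜.IsCausalOn c (Icc a b))
    (hc : EqOn c' c (Icc a b)) : 𝒜.IsCausalOn c' (Icc a b) := by
  refine ⟨h.continuousOn.congr hc, ?_, ?_⟩
  · intro s hs φ hφ hsφ
    rw [hc hs] at hsφ
    obtain ⟨J, hJ, hm⟩ := h.increasing s hs φ hφ hsφ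
    refine ⟨J, hJ, hm.congr fun t ht => ?_⟩
    simp only [hc ht.2]
  · obtain ⟨E, hE, hd⟩ := h.causal
    refine ⟨E ∪ {a, b}, hE.union (by simp), fun s hs hsE hreg => ?_⟩
    simp only [mem_union, mem_insert_iff, mem_singleton_iff, not_or] at hsE
    have hs' : s ∈ Ioo a b :=
      ⟨lt_of_le_of_ne hs.1 (Ne.symm hsE.2.1), lt_of_le_of_ne hs.2 hsE.2.2⟩
    rw [hc hs] at hreg
    obtain ⟨φ, hφ, hsφ, v, hv, hf⟩ := hd s hs hsE.1 hreg
    refine ⟨φ, hφ, by rwa [hc hs], v, ?_, by rwa [hc hs]⟩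
    refine hv.congr_of_eventuallyEq ?_
    filter_upwards [Icc_mem_nhds hs'.1 hs'.2] with t ht
    rw [hc ht]

theorem IsCausalOn.union {c : ℝ → M} {a b d : ℝ} (hab : a ≤ b) (hbd : b ≤ d)
    (h₁ : 𝒜.IsCausalOn c (Icc a b)) (h₂ : 𝒜.IsCausalOn c (Icc b d)) :
    𝒜.IsCausalOn c (Icc a d) := by
  have hU : Icc a b ∪ Icc b d = Icc a d := Icc_union_Icc_eq_Icc hab hbd
  refine ⟨?_, ?_, ?_⟩
  · rw [← hU]
    exact h₁.continuousOn.union_of_isClosed h₂.continuousOn isClosed_Icc isClosed_Icc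
  · intro s hs φ hφ hsφ
    rcases lt_trichotomy s b with hsb | rfl | hsb
    · obtain ⟨J, hJ, hm⟩ := h₁.increasing s ⟨hs.1, hsb.le⟩ φ hφ hsφ
      exact ⟨J ∩ Iio b, inter_mem hJ (Iio_mem_nhds hsb),
        hm.mono fun t ht => ⟨ht.1.1, ht.2.1, le_of_lt ht.1.2⟩⟩
    · obtain ⟨J₁, hJ₁, hm₁⟩ := h₁.increasing s ⟨hab, le_rfl⟩ φ hφ hsφ
      obtain ⟨J₂, hJ₂, hm₂⟩ := h₂.increasing s ⟨le_rfl, hbd⟩ φ hφ hsφ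
      refine ⟨J₁ ∩ J₂, inter_mem hJ₁ hJ₂, ?_⟩
      rw [← hU, inter_union_distrib_left]
      refine StrictMonoOn.union (c := s) (hm₁.mono ?_) (hm₂.mono ?_) ?_ ?_
      · exact inter_subset_inter_left _ inter_subset_left
      · exact inter_subset_inter_left _ inter_subset_right
      · exact ⟨⟨⟨mem_of_mem_nhds hJ₁, mem_of_mem_nhds hJ₂⟩, hab, le_rfl⟩, fun t ht => ht.2.2⟩
      · exact ⟨⟨⟨mem_of_mem_nhds hJ₁, mem_of_mem_nhds hJ₂⟩, le_rfl, hbd⟩, fun t ht => ht.2.1⟩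
    · obtain ⟨J, hJ, hm⟩ := h₂.increasing s ⟨hsb.le, hs.2⟩ φ hφ hsφ
      exact ⟨J ∩ Ioi b, inter_mem hJ (Ioi_mem_nhds hsb),
        hm.mono fun t ht => ⟨ht.1.1, le_of_lt ht.1.2, ht.2.2⟩⟩
  · obtain ⟨E₁, hE₁, hc₁⟩ := h₁.causal
    obtain ⟨E₂, hE₂, hc₂⟩ := h₂.causal
    refine ⟨E₁ ∪ E₂, hE₁.union hE₂, fun s hs hsE hreg => ?_⟩
    rw [mem_union, not_or] at hsE
    rw [← hU] at hs
    rcases hs with hs | hs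
    · exact hc₁ s hs hsE.1 hreg
    · exact hc₂ s hs hsE.2 hreg

theorem isCausalOn_univ_of_Icc {c : ℝ → M}
    (h : ∀ n : ℤ, 𝒜.IsCausalOn c (Icc (n : ℝ) (n + 1))) : 𝒜.IsCausalOn c univ := by
  have hN : ∀ n : ℕ, 𝒜.IsCausalOn c (Icc (-(n : ℝ) - 1) (n + 1)) := by
    intro n
    induction n with
    | zero =>
      have h0 := h 0
      have h1 := h (-1)
      simp only [Int.cast_zero, zero_add, Int.reduceNeg, Int.cast_neg, Int.cast_one,
        neg_add_cancel] at h0 h1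
      simpa using h1.union (by norm_num) (by norm_num) h0
    | succ n ih =>
      have h0 := h (n + 1)
      have h1 := h (-(n : ℤ) - 2)
      have e1 : (((n : ℤ) + 1 : ℤ) : ℝ) = (n : ℝ) + 1 := by push_cast; ring
      have e2 : ((-(n : ℤ) - 2 : ℤ) : ℝ) = -((n + 1 : ℕ) : ℝ) - 1 := by push_cast; ring
      have e3 : -((n + 1 : ℕ) : ℝ) - 1 + 1 = -(n : ℝ) - 1 := by push_cast; ring
      have hn : (0 : ℝ) ≤ n := n.cast_nonneg
      rw [e1] at h0
      rw [e2, e3] at h1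
      push_cast at *
      exact (h1.union (by linarith) (by linarith) ih).union (by linarith) (by linarith) h0
  have hmem : ∀ s : ℝ, ∃ n : ℕ, Icc (-(n : ℝ) - 1) (n + 1) ∈ 𝓝 s := by
    intro s
    obtain ⟨n, hn⟩ := exists_nat_ge |s|
    obtain ⟨h1, h2⟩ := abs_le.mp hn
    exact ⟨n, Icc_mem_nhds (by linarith) (by linarith)⟩
  refine ⟨?_, ?_, ?_⟩
  · rw [continuousOn_univ, continuous_iff_continuousAt]
    intro s
    obtain ⟨n, hn⟩ := hmem s
    exact (hN n).continuousOn.continuousAt hn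
  · intro s _ φ hφ hsφ
    obtain ⟨n, hn⟩ := hmem s
    obtain ⟨J, hJ, hm⟩ := (hN n).increasing s (mem_of_mem_nhds hn) φ hφ hsφ
    exact ⟨J ∩ _, inter_mem hJ hn, hm.mono inter_subset_left⟩
  · choose E hE hc using fun n => (hN n).causal
    refine ⟨⋃ n, E n, countable_iUnion hE, fun s _ hsE hreg => ?_⟩
    obtain ⟨n, hn⟩ := hmem s
    exact hc n s (mem_of_mem_nhds hn) (fun h => hsE (mem_iUnion.mpr ⟨n, h⟩)) hreg

variable (𝒜) in
/-- Some future causal curve runs from `x` to `y`. -/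
def Reach (x y : M) : Prop := ∃ c : ℝ → M, 𝒜.IsCausalOn c (Icc 0 1) ∧ c 0 = x ∧ c 1 = y

theorem IsCausalOn.reach {c : ℝ → M} {a b : ℝ} (h : 𝒜.IsCausalOn c (Icc a b)) (hab : a < b) :
    𝒜.Reach (c a) (c b) := by
  refine ⟨_, (h.comp_affine (sub_pos.mpr hab) a).mono ?_, by simp, by simp⟩
  intro s hs
  simp only [mem_preimage, mem_Icc]
  constructor <;> nlinarith [hs.1, hs.2]

theorem IsCausalOn.isFutureCausalCurve {c : ℝ → M} (h : 𝒜.IsCausalOn c univ) :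
    𝒜.IsFutureCausalCurve c where
  continuous := continuousOn_univ.mp h.continuousOn
  increasing s := by
    obtain ⟨φ, hφ, hs⟩ := 𝒜.cover (c s)
    obtain ⟨J, hJ, hm⟩ := h.increasing s trivial φ hφ hs
    exact ⟨φ, hφ, hs, J, hJ, by simpa using hm⟩
  causal := by
    obtain ⟨E, hE, hc⟩ := h.causal
    exact ⟨E, hE, fun s hs hreg => hc s trivial hs hreg⟩

/-- Concatenation of a two-sided sequence of causal curves. -/
theorem exists_concatenation (σ : ℤ → ℝ → M) (hσ : ∀ n, 𝒜.IsCausalOn (σ n) (Icc 0 1))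
    (hj : ∀ n, σ n 1 = σ (n + 1) 0) :
    ∃ c : ℝ → M, 𝒜.IsCausalOn c univ ∧ ∀ n : ℤ, ∀ s ∈ Icc (0 : ℝ) 1, c (n + s) = σ n s := by
  have key : ∀ n : ℤ, ∀ s ∈ Icc (0 : ℝ) 1,
      σ ⌊(n : ℝ) + s⌋ ((n : ℝ) + s - ⌊(n : ℝ) + s⌋) = σ n s := by
    intro n s hs
    rcases hs.2.lt_or_eq with h1 | rfl
    · have : ⌊(n : ℝ) + s⌋ = n := by
        rw [Int.floor_eq_iff]; constructor <;> linarith [hs.1]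
      rw [this]; simp
    · have : ⌊(n : ℝ) + 1⌋ = n + 1 := by
        rw [Int.floor_eq_iff]; push_cast; constructor <;> linarith
      rw [this]; push_cast; rw [sub_self, hj]
  refine ⟨fun s => σ ⌊s⌋ (s - ⌊s⌋), isCausalOn_univ_of_Icc fun n => ?_, key⟩
  have h1 := ((hσ n).comp_affine one_pos (-(n : ℝ))).mono (I' := Icc (n : ℝ) (n + 1)) ?_
  · refine h1.congr fun s hs => ?_
    have := key n (s - n) ⟨by linarith [hs.1], by linarith [hs.2]⟩
    simp only [add_sub_cancel] at this
    simp only [this, one_mul]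
    rfl
  · intro s hs
    simp only [mem_preimage, mem_Icc]
    constructor <;> linarith [hs.1, hs.2]

end Atlas

/-! ### Inextendible extensions -/

/-- If from each point of each member of a countable open cover one can jump out of that member,
then from any point one can jump forever without converging: jump out of the members of the cover
in turn, coming back to each of them infinitely often. -/
theorem exists_escaping_sequence {X : Type*} [TopologicalSpace X] {R : X → X → Prop}
    {V : ℕ → Set X} (hV : ∀ k, IsOpen (V k)) (hcov : ∀ x, ∃ k, x ∈ V k)
    (hR : ∀ k, ∀ x ∈ V k, ∃ y ∉ V k, R x y) (x : X) :
    ∃ u : ℕ → X, u 0 = x ∧ (∀ n, R (u n) (u (n + 1))) ∧ ¬ ∃ p, Tendsto u atTop (𝓝 p) := by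
  -- A state is a point together with the number of turns already used; in turn `m` it is the
  -- member `V (m.unpair).1` that is left, if it contains the current point.
  have hstep : ∀ st : X × ℕ, ∃ st' : X × ℕ, R st.1 st'.1 ∧ st.2 < st'.2 ∧
      ∀ m, st.2 ≤ m → m < st'.2 → st.1 ∈ V m.unpair.1 → st'.1 ∉ V m.unpair.1 := by
    rintro ⟨x, n⟩
    have hex : ∃ m, n ≤ m ∧ x ∈ V m.unpair.1 := by
      obtain ⟨k, hk⟩ := hcov x
      exact ⟨Nat.pair k n, Nat.right_le_pair k n, by simpa using hk⟩
    classical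
    obtain ⟨hm1, hm2⟩ := Nat.find_spec hex
    obtain ⟨y, hy, hxy⟩ := hR _ x hm2
    refine ⟨(y, Nat.find hex + 1), hxy, by simpa using Nat.lt_succ_of_le hm1, ?_⟩
    intro m h1 h2 h3
    have : m = Nat.find hex :=
      le_antisymm (Nat.lt_succ_iff.mp h2) (Nat.find_min' hex ⟨h1, h3⟩)
    rwa [this]
  choose f hfR hflt hfV using hstep
  set st : ℕ → X × ℕ := fun n => f^[n] (x, 0) with hst
  have hsucc : ∀ n, st (n + 1) = f (st n) := fun n => Function.iterate_succ_apply' f n _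
  refine ⟨fun n => (st n).1, rfl, fun n => by simpa only [hsucc] using hfR (st n), ?_⟩
  rintro ⟨p, hp⟩
  obtain ⟨k, hk⟩ := hcov p
  obtain ⟨N, hN⟩ := eventually_atTop.mp (hp.eventually ((hV k).mem_nhds hk))
  set m := Nat.pair k (st N).2 with hm
  have hkm : m.unpair.1 = k := by simp [hm]
  have hall : ∀ j, j + (st N).2 ≤ (st (N + j)).2 ∧ (st (N + j)).2 ≤ m := by
    intro j
    induction j with
    | zero => exact ⟨by simp, Nat.right_le_pair _ _⟩
    | succ j ih =>
      have h1 := hflt (st (N + j))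
      rw [← hsucc] at h1
      refine ⟨by have := ih.1; rw [← add_assoc N j 1]; omega, ?_⟩
      by_contra hlt
      rw [not_le] at hlt
      refine hfV (st (N + j)) m ih.2 (by rw [← hsucc]; exact hlt) ?_ ?_
      · rw [hkm]; exact hN _ (by omega)
      · rw [hkm, ← hsucc]; exact hN _ (by omega)
  have := hall (m + 1)
  omega

/-! ### Causal curves in a chart -/

namespace Atlas

variable {A : Set ℝ} {M : Type*} [TopologicalSpace M] {𝒜 : Atlas A M}

theorem hasDerivAt_fst_comp {γ : ℝ → ℝ × ℂ} {v : ℝ × ℂ} {s : ℝ} (h : HasDerivAt γ v s) :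
    HasDerivAt (fun t => (γ t).1) v.1 s :=
  (hasFDerivAt_fst (𝕜 := ℝ) (p := γ s)).comp_hasDerivAt s h

theorem mem_reg_iff {φ : ℝ × OpenPartialHomeomorph M (ℝ × ℂ)} (hφ : φ ∈ 𝒜.charts) {x : M}
    (hx : x ∈ φ.2.source) : x ∈ 𝒜.reg ↔ φ.2 x ∈ modelReg φ.1 := by
  refine ⟨?_, fun h => ⟨φ, hφ, hx, h⟩⟩
  rintro ⟨ψ, hψ, hxψ, h⟩
  exact 𝒜.reg_to_reg ψ hψ φ hφ x ⟨hxψ, hx⟩ h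

theorem hasDerivAt_chart_change {φ ψ : ℝ × OpenPartialHomeomorph M (ℝ × ℂ)} (hφ : φ ∈ 𝒜.charts)
    (hψ : ψ ∈ 𝒜.charts) {c : ℝ → M} {s : ℝ} (hc : ContinuousAt c s) (hsφ : c s ∈ φ.2.source)
    (hsψ : c s ∈ ψ.2.source) (hreg : φ.2 (c s) ∈ modelReg φ.1) {v : ℝ × ℂ}
    (hv : HasDerivAt (fun t => φ.2 (c t)) v s) :
    HasDerivAt (fun t => ψ.2 (c t)) (fderiv ℝ (ψ.2 ∘ φ.2.symm) (φ.2 (c s)) v) s := by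
  have h1 := ((𝒜.compatible φ hφ ψ hψ (c s) ⟨hsφ, hsψ⟩ hreg).smooth.differentiableAt
    (by simp)).hasFDerivAt
  refine (h1.comp_hasDerivAt s hv).congr_of_eventuallyEq ?_
  filter_upwards [hc (φ.2.open_source.mem_nhds hsφ)] with t ht
  simp [φ.2.left_inv ht]

/-- Curves that may be singular at their ends only. That the first coordinate increases in every
chart, and not only in `φ`, is due to changes of charts preserving future vectors. -/
theorem isCausalOn_of_chart {φ : ℝ × OpenPartialHomeomorph M (ℝ × ℂ)} (hφ : φ ∈ 𝒜.charts)
    {γ : ℝ → ℝ × ℂ} {a b : ℝ} (hγ : ContinuousOn γ (Icc a b))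
    (htar : ∀ s ∈ Icc a b, γ s ∈ φ.2.target)
    (h : ∀ s ∈ Ioo a b, γ s ∈ modelReg φ.1 ∧
      ∃ v, HasDerivAt γ v s ∧ FutureCausal φ.1 (γ s) v) :
    𝒜.IsCausalOn (fun s => φ.2.symm (γ s)) (Icc a b) := by
  have hcont : ContinuousOn (fun s => φ.2.symm (γ s)) (Icc a b) :=
    φ.2.continuousOn_symm.comp hγ htar
  have hd : ∀ s ∈ Ioo a b, ∃ v, HasDerivAt (fun t => φ.2 (φ.2.symm (γ t))) v s ∧
      FutureCausal φ.1 (φ.2 (φ.2.symm (γ s))) v := by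
    intro s hs
    obtain ⟨-, v, hv, hf⟩ := h s hs
    refine ⟨v, hv.congr_of_eventuallyEq ?_, ?_⟩
    · filter_upwards [Icc_mem_nhds hs.1 hs.2] with t ht
      exact φ.2.right_inv (htar t ht)
    · rwa [φ.2.right_inv (htar s (Ioo_subset_Icc_self hs))]
  refine ⟨hcont, ?_, ?_⟩
  · intro s hs ψ hψ hsψ
    have hev : ∀ᶠ t in 𝓝[Icc a b] s, φ.2.symm (γ t) ∈ ψ.2.source :=
      hcont s hs (ψ.2.open_source.mem_nhds hsψ)
    obtain ⟨ε, hε, hball⟩ := Metric.mem_nhdsWithin_iff.mp hev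
    refine ⟨Metric.ball s ε, Metric.ball_mem_nhds s hε, ?_⟩
    refine strictMonoOn_of_deriv_pos ((convex_ball s ε).inter (convex_Icc a b)) ?_ ?_
    · exact continuous_fst.comp_continuousOn
        (ψ.2.continuousOn.comp (hcont.mono inter_subset_right) fun t ht => hball ht)
    · intro t ht
      rw [interior_inter, interior_Icc] at ht
      have htI : t ∈ Icc a b := Ioo_subset_Icc_self ht.2
      have htψ := hball ⟨interior_subset ht.1, htI⟩
      have htφ : φ.2.symm (γ t) ∈ φ.2.source := φ.2.map_target (htar t htI)
      have hreg : φ.2 (φ.2.symm (γ t)) ∈ modelReg φ.1 := by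
        rw [φ.2.right_inv (htar t htI)]; exact (h t ht.2).1
      obtain ⟨v, hv, hf⟩ := hd t ht.2
      have h1 := hasDerivAt_chart_change hφ hψ
        (hcont.continuousAt (Icc_mem_nhds ht.2.1 ht.2.2)) htφ htψ hreg hv
      have h2 := (𝒜.compatible φ hφ ψ hψ _ ⟨htφ, htψ⟩ hreg).time_orientation v hf
      rw [(hasDerivAt_fst_comp h1).deriv]
      exact h2.2
  · refine ⟨{a, b}, by simp, fun s hs hsE _ => ?_⟩
    simp only [mem_insert_iff, mem_singleton_iff, not_or] at hsE
    obtain ⟨v, hv⟩ := hd s ⟨lt_of_le_of_ne hs.1 (Ne.symm hsE.1), lt_of_le_of_ne hs.2 hsE.2⟩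
    exact ⟨φ, hφ, φ.2.map_target (htar s hs), v, hv⟩

/-- Vertical segments are causal, also on the axis. There the first coordinate of another chart is
nondecreasing as a limit of what happens on nearby vertical segments, and it is strictly
increasing since charts are injective and map singular points to the axis. -/
theorem isCausalOn_vertical {φ : ℝ × OpenPartialHomeomorph M (ℝ × ℂ)} (hφ : φ ∈ 𝒜.charts)
    {t h : ℝ} {z : ℂ} (hh : 0 < h) (htar : ∀ s ∈ Icc (0 : ℝ) 1, (t + s * h, z) ∈ φ.2.target) :
    𝒜.IsCausalOn (fun s => φ.2.symm (t + s * h, z)) (Icc 0 1) := by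
  have hder : ∀ (w : ℂ) (s : ℝ), HasDerivAt (fun s : ℝ => ((t + s * h, w) : ℝ × ℂ)) (h, 0) s := by
    intro w s
    have h1 : HasDerivAt (fun s : ℝ => t + s * h) h s := by
      simpa using ((hasDerivAt_id s).mul_const h).const_add t
    exact h1.prodMk (hasDerivAt_const s w)
  have hfut : ∀ (α : ℝ) (x : ℝ × ℂ), FutureCausal α x (h, 0) := by
    intro α x
    simpa using (futureCausal_vertical α x).smul hh
  by_cases hz : z ≠ 0 ∨ φ.1 = 2 * Real.pi
  · refine isCausalOn_of_chart hφ (by fun_prop) htar fun s _ => ⟨hz, _, hder z s, hfut _ _⟩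
  push Not at hz
  obtain ⟨rfl, hα⟩ := hz
  have hsing : ∀ s ∈ Icc (0 : ℝ) 1, ∀ ψ ∈ 𝒜.charts, φ.2.symm (t + s * h, 0) ∈ ψ.2.source →
      ψ.2 (φ.2.symm (t + s * h, 0)) ∉ modelReg ψ.1 := by
    intro s hs ψ hψ hsψ hreg
    have := 𝒜.reg_to_reg ψ hψ φ hφ _ ⟨hsψ, φ.2.map_target (htar s hs)⟩ hreg
    rw [φ.2.right_inv (htar s hs)] at this
    rcases this with h | h
    · exact h rfl
    · exact hα h
  refine ⟨φ.2.continuousOn_symm.comp (by fun_prop) htar, ?_, ?_⟩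
  · intro s hs ψ hψ hsψ
    set W : Set (ℝ × ℂ) := φ.2.target ∩ φ.2.symm ⁻¹' ψ.2.source with hW
    have hWo : IsOpen W := φ.2.isOpen_inter_preimage_symm ψ.2.open_source
    obtain ⟨ε, hε, hball⟩ := Metric.isOpen_iff.mp hWo (t + s * h, 0) ⟨htar s hs, hsψ⟩
    have hmem : ∀ s' ∈ Metric.ball s (ε / h), ∀ w ∈ Metric.ball (0 : ℂ) ε,
        (t + s' * h, w) ∈ W := by
      intro s' hs' w hw
      refine hball ?_
      rw [Metric.mem_ball, Prod.dist_eq, max_lt_iff]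
      refine ⟨?_, hw⟩
      rw [Metric.mem_ball, Real.dist_eq, lt_div_iff₀ hh] at hs'
      rw [Real.dist_eq, show t + s' * h - (t + s * h) = (s' - s) * h by ring, abs_mul,
        abs_of_pos hh]
      exact hs'
    have hΦc : ContinuousOn (fun x => ψ.2 (φ.2.symm x)) W :=
      ψ.2.continuousOn.comp (φ.2.continuousOn_symm.mono inter_subset_left) fun x hx => hx.2
    have hmono : ∀ w ∈ Metric.ball (0 : ℂ) ε, w ≠ 0 →
        StrictMonoOn (fun s' => (ψ.2 (φ.2.symm (t + s' * h, w))).1) (Metric.ball s (ε / h)) := by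
      intro w hw hw0
      have hd : ∀ s' ∈ Metric.ball s (ε / h), ∃ a, 0 < a ∧
          HasDerivAt (fun s' => (ψ.2 (φ.2.symm (t + s' * h, w))).1) a s' := by
        intro s' hs'
        have hx := hmem s' hs' w hw
        have hreg : φ.2 (φ.2.symm (t + s' * h, w)) ∈ modelReg φ.1 := by
          rw [φ.2.right_inv hx.1]; exact Or.inl hw0
        have hcomp := 𝒜.compatible φ hφ ψ hψ _ ⟨φ.2.map_target hx.1, hx.2⟩ hreg
        rw [φ.2.right_inv hx.1] at hcomp
        have h1 := (hcomp.smooth.differentiableAt (by simp)).hasFDerivAt.comp_hasDerivAt s'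
          (hder w s')
        exact ⟨_, (hcomp.time_orientation _ (hfut _ _)).2, hasDerivAt_fst_comp h1⟩
      refine strictMonoOn_of_deriv_pos (convex_ball _ _) ?_ ?_
      · intro s' hs'
        obtain ⟨a, -, ha⟩ := hd s' hs'
        exact ha.continuousAt.continuousWithinAt
      · intro s' hs'
        obtain ⟨a, ha0, ha⟩ := hd s' (interior_subset hs')
        rwa [ha.deriv]
    refine ⟨Metric.ball s (ε / h), Metric.ball_mem_nhds s (by positivity), ?_⟩
    rintro a ⟨ha, haI⟩ b ⟨hb, hbI⟩ hab
    have h0 : (0 : ℂ) ∈ Metric.ball (0 : ℂ) ε := Metric.mem_ball_self hε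
    have hlim : ∀ s' ∈ Metric.ball s (ε / h), Tendsto
        (fun w => (ψ.2 (φ.2.symm (t + s' * h, w))).1) (𝓝[≠] (0 : ℂ))
        (𝓝 (ψ.2 (φ.2.symm (t + s' * h, 0))).1) := by
      intro s' hs'
      have h1 : ContinuousAt (fun x => ψ.2 (φ.2.symm x)) (t + s' * h, 0) :=
        hΦc.continuousAt (hWo.mem_nhds (hmem s' hs' 0 h0))
      have h2 : Tendsto (fun w : ℂ => ((t + s' * h, w) : ℝ × ℂ)) (𝓝[≠] 0)
          (𝓝 (t + s' * h, 0)) :=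
        (Continuous.tendsto (by fun_prop) 0).mono_left nhdsWithin_le_nhds
      exact (continuous_fst.tendsto _).comp (h1.tendsto.comp h2)
    have hle : (ψ.2 (φ.2.symm (t + a * h, 0))).1 ≤ (ψ.2 (φ.2.symm (t + b * h, 0))).1 := by
      refine le_of_tendsto_of_tendsto (hlim a ha) (hlim b hb) ?_
      filter_upwards [self_mem_nhdsWithin,
        nhdsWithin_le_nhds (Metric.ball_mem_nhds (0 : ℂ) hε)] with w hw hwε
      exact (hmono w hwε hw ha hb hab).le
    refine lt_of_le_of_ne hle fun heq => ?_
    have hzero : ∀ s' ∈ Icc (0 : ℝ) 1, s' ∈ Metric.ball s (ε / h) →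
        (ψ.2 (φ.2.symm (t + s' * h, 0))).2 = 0 := by
      intro s' hs' hs''
      by_contra hne
      exact hsing s' hs' ψ hψ (hmem s' hs'' 0 h0).2 (Or.inl hne)
    have h1 : ψ.2 (φ.2.symm (t + a * h, 0)) = ψ.2 (φ.2.symm (t + b * h, 0)) :=
      Prod.ext heq ((hzero a haI ha).trans (hzero b hbI hb).symm)
    have h2 := ψ.2.injOn (hmem a ha 0 h0).2 (hmem b hb 0 h0).2 h1
    have h3 := φ.2.symm.injOn (htar a haI) (htar b hbI) h2
    have h4 : a * h = b * h := by simpa using congrArg Prod.fst h3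
    exact hab.ne (mul_right_cancel₀ hh.ne' h4)
  · refine ⟨∅, countable_empty, fun s hs _ hreg => ?_⟩
    exact absurd ((mem_reg_iff hφ (φ.2.map_target (htar s hs))).mp hreg)
      (hsing s hs φ hφ (φ.2.map_target (htar s hs)))

theorem reach_vertical {φ : ℝ × OpenPartialHomeomorph M (ℝ × ℂ)} (hφ : φ ∈ 𝒜.charts)
    {t t' : ℝ} {z : ℂ} (h : t < t') (htar : ∀ s ∈ Icc t t', (s, z) ∈ φ.2.target) :
    𝒜.Reach (φ.2.symm (t, z)) (φ.2.symm (t', z)) := by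
  have h1 := isCausalOn_vertical (t := t) (z := z) hφ (sub_pos.mpr h) fun s hs => htar _
    ⟨by nlinarith [hs.1, hs.2], by nlinarith [hs.1, hs.2]⟩
  simpa using h1.reach one_pos

/-- Every causal curve with a break point extends to an inextendible one: beyond its ends, run
along vertical segments across the boxes of a countable cover by boxes. -/
theorem exists_inextendible [SecondCountableTopology M] {c₁ c₂ : ℝ → M}
    (h₁ : 𝒜.IsCausalOn c₁ (Icc 0 1)) (h₂ : 𝒜.IsCausalOn c₂ (Icc 0 1)) (h₁₂ : c₁ 1 = c₂ 0) :
    ∃ c : ℝ → M, 𝒜.IsCausalOn c univ ∧ 𝒜.IsInextendibleCausalCurve c ∧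
      (∀ s ∈ Icc (0 : ℝ) 1, c s = c₁ s) ∧ (∀ s ∈ Icc (0 : ℝ) 1, c (1 + s) = c₂ s) := by
  have hbox : ∀ x : M, ∃ V : Set M, IsOpen V ∧ x ∈ V ∧
      (∀ y ∈ V, ∃ y' ∉ V, 𝒜.Reach y y') ∧ (∀ y ∈ V, ∃ y' ∉ V, 𝒜.Reach y' y) := by
    intro x
    obtain ⟨φ, hφ, hx⟩ := 𝒜.cover x
    obtain ⟨δ, hδ, hball⟩ := Metric.nhds_basis_closedBall.mem_iff.mp
      (φ.2.open_target.mem_nhds (φ.2.map_source hx))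
    have htar : ∀ y ∈ φ.2.source ∩ φ.2 ⁻¹' Metric.ball (φ.2 x) δ,
        ∀ s ∈ Icc ((φ.2 x).1 - δ) ((φ.2 x).1 + δ), (s, (φ.2 y).2) ∈ φ.2.target := by
      rintro y ⟨hy, hyb⟩ s hs
      refine hball ?_
      rw [mem_preimage, Metric.mem_ball, Prod.dist_eq, max_lt_iff] at hyb
      rw [Metric.mem_closedBall, Prod.dist_eq, max_le_iff]
      refine ⟨?_, hyb.2.le⟩
      rw [Real.dist_eq, abs_le]
      constructor <;> linarith [hs.1, hs.2]
    have hout : ∀ y ∈ φ.2.source ∩ φ.2 ⁻¹' Metric.ball (φ.2 x) δ,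
        ∀ s ∈ Icc ((φ.2 x).1 - δ) ((φ.2 x).1 + δ), δ ≤ |s - (φ.2 x).1| →
        φ.2.symm (s, (φ.2 y).2) ∉ φ.2.source ∩ φ.2 ⁻¹' Metric.ball (φ.2 x) δ := by
      rintro y hy s hs hsδ ⟨-, h⟩
      rw [mem_preimage, φ.2.right_inv (htar y hy s hs), Metric.mem_ball, Prod.dist_eq,
        max_lt_iff, Real.dist_eq] at h
      linarith [h.1]
    have hlt : ∀ y ∈ φ.2.source ∩ φ.2 ⁻¹' Metric.ball (φ.2 x) δ,
        (φ.2 x).1 - δ < (φ.2 y).1 ∧ (φ.2 y).1 < (φ.2 x).1 + δ := by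
      rintro y ⟨-, hyb⟩
      rw [mem_preimage, Metric.mem_ball, Prod.dist_eq, max_lt_iff, Real.dist_eq, abs_lt] at hyb
      constructor <;> linarith [hyb.1.1, hyb.1.2]
    refine ⟨φ.2.source ∩ φ.2 ⁻¹' Metric.ball (φ.2 x) δ,
      φ.2.isOpen_inter_preimage Metric.isOpen_ball, ⟨hx, Metric.mem_ball_self hδ⟩,
      fun y hy => ?_, fun y hy => ?_⟩
    · have hend : (φ.2 x).1 + δ ∈ Icc ((φ.2 x).1 - δ) ((φ.2 x).1 + δ) :=
        ⟨by linarith, le_rfl⟩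
      refine ⟨_, hout y hy _ hend (by simp [abs_of_pos hδ]), ?_⟩
      have := reach_vertical (z := (φ.2 y).2) hφ (hlt y hy).2 fun s hs =>
        htar y hy s ⟨(hlt y hy).1.le.trans hs.1, hs.2⟩
      simpa [φ.2.left_inv hy.1] using this
    · have hend : (φ.2 x).1 - δ ∈ Icc ((φ.2 x).1 - δ) ((φ.2 x).1 + δ) :=
        ⟨le_rfl, by linarith⟩
      refine ⟨_, hout y hy _ hend (by simp [abs_of_pos hδ]), ?_⟩
      have := reach_vertical (z := (φ.2 y).2) hφ (hlt y hy).1 fun s hs =>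
        htar y hy s ⟨hs.1, hs.2.trans (hlt y hy).2.le⟩
      simpa [φ.2.left_inv hy.1] using this
  choose V hVo hVx hVf hVp using hbox
  obtain ⟨t, htc, htV⟩ := TopologicalSpace.countable_cover_nhds fun x => (hVo x).mem_nhds (hVx x)
  have hcov' : ∀ x : M, ∃ y ∈ t, x ∈ V y := by
    intro x
    simpa using (eq_univ_iff_forall.mp htV) x
  have htne : t.Nonempty := by
    obtain ⟨y, hy, -⟩ := hcov' (c₁ 0)
    exact ⟨y, hy⟩
  obtain ⟨g, rfl⟩ := htc.exists_eq_range htne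
  have hcov : ∀ x : M, ∃ k : ℕ, x ∈ V (g k) := by
    intro x
    obtain ⟨y, ⟨k, rfl⟩, hy⟩ := hcov' x
    exact ⟨k, hy⟩
  obtain ⟨u, hu0, hu, hulim⟩ := exists_escaping_sequence (R := 𝒜.Reach)
    (fun k => hVo (g k)) hcov (fun k => hVf (g k)) (c₂ 1)
  obtain ⟨w, hw0, hw, hwlim⟩ := exists_escaping_sequence (R := fun x y => 𝒜.Reach y x)
    (fun k => hVo (g k)) hcov (fun k => hVp (g k)) (c₁ 0)
  choose f hf hf0 hf1 using hu
  choose p hp hp0 hp1 using hw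
  let σ : ℤ → ℝ → M := fun n => match n with
    | Int.ofNat 0 => c₁
    | Int.ofNat 1 => c₂
    | Int.ofNat (n + 2) => f n
    | Int.negSucc n => p n
  obtain ⟨c, hc, hcσ⟩ := exists_concatenation (𝒜 := 𝒜) σ
    (by
      rintro ((_ | _ | n) | n)
      exacts [h₁, h₂, hf n, hp n])
    (by
      rintro ((_ | _ | n) | (_ | n))
      · exact h₁₂
      · exact hu0.symm.trans (hf0 0).symm
      · exact (hf1 n).trans (hf0 (n + 1)).symm
      · exact (hp1 0).trans hw0
      · exact (hp1 (n + 1)).trans (hp0 n).symm)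
  refine ⟨c, hc, ⟨hc.isFutureCausalCurve, ?_, ?_⟩, ?_, ?_⟩
  · rintro ⟨q, hq⟩
    refine hulim ⟨q, ?_⟩
    have h1 : Tendsto (fun n : ℕ => ((n : ℝ) + 2)) atTop atTop :=
      tendsto_atTop_add_const_right _ _ tendsto_natCast_atTop_atTop
    refine (hq.comp h1).congr fun n => ?_
    have := hcσ (n + 2) 0 (by simp)
    push_cast at this
    rw [add_zero] at this
    exact this.trans (hf0 n)
  · rintro ⟨q, hq⟩
    refine hwlim ⟨q, ?_⟩
    have h1 : Tendsto (fun n : ℕ => -(n : ℝ)) atTop atBot :=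
      tendsto_neg_atTop_atBot.comp tendsto_natCast_atTop_atTop
    refine (hq.comp h1).congr fun n => ?_
    have := hcσ (Int.negSucc n) 1 (by simp)
    rw [Int.cast_negSucc] at this
    push_cast at this
    rw [show -((n : ℝ) + 1) + 1 = -n by ring] at this
    exact this.trans (hp1 n)
  · intro s hs
    simpa using hcσ 0 s hs
  · intro s hs
    simpa using hcσ 1 s hs

theorem Reach.trans [SecondCountableTopology M] {x y z : M} (h₁ : 𝒜.Reach x y)
    (h₂ : 𝒜.Reach y z) : 𝒜.Reach x z := by
  obtain ⟨c₁, hc₁, rfl, h1⟩ := h₁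
  obtain ⟨c₂, hc₂, h2, rfl⟩ := h₂
  obtain ⟨c, hc, -, e₁, e₂⟩ := exists_inextendible hc₁ hc₂ (h1.trans h2.symm)
  have := (hc.mono (subset_univ (Icc 0 (1 + 1)))).reach (by norm_num)
  rwa [e₁ 0 (by simp), e₂ 1 (by simp)] at this

/-- Cauchy surfaces are acausal. -/
theorem IsCauchySurface.not_reach [SecondCountableTopology M] {S : Set M}
    (hS : 𝒜.IsCauchySurface S) {x y : M} (hx : x ∈ S) (hy : y ∈ S) : ¬ 𝒜.Reach x y := by
  rintro ⟨c₁, hc₁, rfl, rfl⟩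
  obtain ⟨c₂, hc₂, h2⟩ : ∃ c₂, 𝒜.IsCausalOn c₂ (Icc 0 1) ∧ c₂ 0 = c₁ 1 := by
    obtain ⟨φ, hφ, hφs⟩ := 𝒜.cover (c₁ 1)
    obtain ⟨δ, hδ, hball⟩ := Metric.isOpen_iff.mp φ.2.open_target _ (φ.2.map_source hφs)
    refine ⟨_, isCausalOn_vertical (t := (φ.2 (c₁ 1)).1) (z := (φ.2 (c₁ 1)).2) (h := δ / 2) hφ
      (by positivity) fun s hs => hball ?_, by simp [φ.2.left_inv hφs]⟩
    rw [Metric.mem_ball, Prod.dist_eq, max_lt_iff]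
    simp only [Real.dist_eq, dist_self]
    refine ⟨?_, hδ⟩
    rw [abs_lt]; constructor <;> nlinarith [hs.1, hs.2]
  obtain ⟨c, hc, hci, e₁, e₂⟩ := exists_inextendible hc₁ hc₂ h2.symm
  obtain ⟨s, -, hu⟩ := hS.meets_once c hci
  have h0 := hu 0 (by simpa [e₁ 0 (by simp)] using hx)
  have h1 := hu 1 (by simpa [e₁ 1 (by simp)] using hy)
  rw [← h1] at h0
  norm_num at h0

/-- A Cauchy surface meets the union of a broken causal curve, the causal past of its origin and
the causal future of its end. -/
theorem IsCauchySurface.exists_mem [SecondCountableTopology M] {S : Set M}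
    (hS : 𝒜.IsCauchySurface S) {c₁ c₂ : ℝ → M}
    (h₁ : 𝒜.IsCausalOn c₁ (Icc 0 1)) (h₂ : 𝒜.IsCausalOn c₂ (Icc 0 1)) (h₁₂ : c₁ 1 = c₂ 0) :
    ∃ m ∈ S, 𝒜.Reach m (c₁ 0) ∨ (∃ s ∈ Icc (0 : ℝ) 1, m = c₁ s) ∨
      (∃ s ∈ Icc (0 : ℝ) 1, m = c₂ s) ∨ 𝒜.Reach (c₂ 1) m := by
  obtain ⟨c, hc, hci, e₁, e₂⟩ := exists_inextendible h₁ h₂ h₁₂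
  obtain ⟨s, hs, -⟩ := hS.meets_once c hci
  refine ⟨c s, hs, ?_⟩
  rcases lt_or_ge s 0 with h | h
  · left
    have := (hc.mono (subset_univ (Icc s 0))).reach h
    rwa [e₁ 0 (by simp)] at this
  rcases le_or_gt s 1 with h' | h'
  · exact Or.inr (Or.inl ⟨s, ⟨h, h'⟩, e₁ s ⟨h, h'⟩⟩)
  rcases le_or_gt s (1 + 1) with h'' | h''
  · refine Or.inr (Or.inr (Or.inl ⟨s - 1, ⟨by linarith, by linarith⟩, ?_⟩))
    rw [← e₂ (s - 1) ⟨by linarith, by linarith⟩]; ring_nf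
  · refine Or.inr (Or.inr (Or.inr ?_))
    have := (hc.mono (subset_univ (Icc (1 + 1) s))).reach h''
    rwa [e₂ 1 (by simp)] at this

end Atlas

/-! ### Closedness of Cauchy surfaces -/

/-- The bounds on the slope hold because `80 > 8 π²`. -/
theorem futureCausal_spiral {α τ T R r r₁ δ : ℝ} {e : ℂ} (he : ‖e‖ = 1) (hR : 0 < R)
    (hR₁ : R ≤ r₁) (hr0 : 0 ≤ r) (hr : r ≤ r₁ / 2) (hδ : |δ| ≤ 2 * Real.pi)
    (hT : (80 + |α|) * r₁ ≤ T) :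
    FutureCausal α (τ, R * e) (T, (((r₁ - r : ℝ) : ℂ) + ((R * δ : ℝ) : ℂ) * Complex.I) * e) := by
  have hr₁ : 0 < r₁ := hR.trans_le hR₁
  have hα := abs_nonneg α
  have hT0 : 0 < T := lt_of_lt_of_le (by positivity) hT
  have he0 : e ≠ 0 := by rintro rfl; simp at he
  have hx : ((τ, R * e) : ℝ × ℂ).2 ≠ 0 := mul_ne_zero (by exact_mod_cast hR.ne') he0
  have h1 : dr (τ, R * e) (T, (((r₁ - r : ℝ) : ℂ) + ((R * δ : ℝ) : ℂ) * Complex.I) * e) =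
      r₁ - r := by
    rw [dr_mul_unit hR he]; simp
  have h2 : rdtheta (τ, R * e) (T, (((r₁ - r : ℝ) : ℂ) + ((R * δ : ℝ) : ℂ) * Complex.I) * e) =
      R * δ := by
    rw [rdtheta_mul_unit hR he]; simp
  have hδ2 : δ ^ 2 ≤ (2 * Real.pi) ^ 2 := sq_le_sq' (abs_le.mp hδ).1 (abs_le.mp hδ).2
  have hR2 : R ^ 2 ≤ r₁ ^ 2 := by gcongr
  refine ⟨?_, hT0⟩
  by_cases h0 : α = 0
  · subst h0
    rw [ds2_zero_eq _ _ hx, h1, h2]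
    simp only [abs_zero, add_zero] at hT
    have hpi : Real.pi ^ 2 ≤ 10 := by nlinarith [Real.pi_lt_d2, Real.pi_pos]
    have h3 : (R * δ) ^ 2 ≤ 40 * r₁ ^ 2 := by
      rw [mul_pow]
      calc R ^ 2 * δ ^ 2 ≤ r₁ ^ 2 * (2 * Real.pi) ^ 2 := by gcongr
        _ ≤ 40 * r₁ ^ 2 := by nlinarith [sq_nonneg r₁]
    have h4 : 80 * r₁ * (r₁ - r) ≤ T * (r₁ - r) :=
      mul_le_mul_of_nonneg_right hT (by linarith)
    simp only
    nlinarith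
  · rw [ds2_eq _ h0 _ _ hx, h1, h2]
    have h3 : (α / (2 * Real.pi)) ^ 2 * (R * δ) ^ 2 ≤ α ^ 2 * r₁ ^ 2 := by
      calc (α / (2 * Real.pi)) ^ 2 * (R * δ) ^ 2
          = (α / (2 * Real.pi)) ^ 2 * (R ^ 2 * δ ^ 2) := by ring
        _ ≤ (α / (2 * Real.pi)) ^ 2 * (r₁ ^ 2 * (2 * Real.pi) ^ 2) := by gcongr
        _ = α ^ 2 * r₁ ^ 2 := by field_simp
    have h4 : ((80 + |α|) * r₁) ^ 2 ≤ T ^ 2 := by gcongr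
    have h5 : (r₁ - r) ^ 2 ≤ r₁ ^ 2 := by
      apply pow_le_pow_left₀ <;> linarith
    have h6 : |α| ^ 2 = α ^ 2 := sq_abs α
    simp only
    nlinarith [mul_nonneg hα (sq_nonneg r₁)]

namespace Atlas

variable {A : Set ℝ} {M : Type*} [TopologicalSpace M] {𝒜 : Atlas A M}

theorem isCausalOn_spiral {φ : ℝ × OpenPartialHomeomorph M (ℝ × ℂ)} (hφ : φ ∈ 𝒜.charts)
    {t T r r₁ θ δ : ℝ} (hr₁ : 0 < r₁) (hr0 : 0 ≤ r) (hr : r ≤ r₁ / 2)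
    (hδ : |δ| ≤ 2 * Real.pi) (hT : (80 + |φ.1|) * r₁ ≤ T)
    (htar : ∀ s ∈ Icc (0 : ℝ) 1, ((t + s * T, ((r + s * (r₁ - r) : ℝ) : ℂ) *
      Complex.exp ((θ + s * δ : ℝ) * Complex.I)) : ℝ × ℂ) ∈ φ.2.target) :
    𝒜.IsCausalOn (fun s => φ.2.symm (t + s * T, ((r + s * (r₁ - r) : ℝ) : ℂ) *
      Complex.exp ((θ + s * δ : ℝ) * Complex.I))) (Icc 0 1) := by
  refine isCausalOn_of_chart hφ (by fun_prop) htar fun s hs => ?_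
  have hR : 0 < r + s * (r₁ - r) := by nlinarith [hs.1]
  refine ⟨Or.inl (mul_ne_zero (by exact_mod_cast hR.ne') (Complex.exp_ne_zero _)), _, ?_,
    futureCausal_spiral (Complex.norm_exp_ofReal_mul_I _) hR ?_ hr0 hr hδ hT⟩
  · have h1 : HasDerivAt (fun s : ℝ => t + s * T) T s := by
      simpa using ((hasDerivAt_id s).mul_const T).const_add t
    have h2 : HasDerivAt (fun s : ℝ => r + s * (r₁ - r)) (r₁ - r) s := by
      simpa using ((hasDerivAt_id s).mul_const (r₁ - r)).const_add r
    have h3 : HasDerivAt (fun s : ℝ => θ + s * δ) δ s := by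
      simpa using ((hasDerivAt_id s).mul_const δ).const_add θ
    have h4 := h2.ofReal_comp.mul (h3.ofReal_comp.mul_const Complex.I).cexp
    refine (h1.prodMk h4).congr_deriv ?_
    push_cast
    ext1
    · rfl
    · simp only; ring
  · nlinarith [hs.1, hs.2]

theorem mem_ball_axis {t₀ ε : ℝ} {x : ℝ × ℂ} :
    x ∈ Metric.ball ((t₀, 0) : ℝ × ℂ) ε ↔ |x.1 - t₀| < ε ∧ ‖x.2‖ < ε := by
  rw [Metric.mem_ball, Prod.dist_eq, max_lt_iff, Real.dist_eq, dist_zero_right]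

/-- Near the axis, one can go away from the axis in a causal way, to any direction and at the cost
of a time proportional to the radius. In the BTZ case there is no way back to the axis. -/
theorem exists_outward {φ : ℝ × OpenPartialHomeomorph M (ℝ × ℂ)} (hφ : φ ∈ 𝒜.charts)
    {t₀ ε : ℝ} (hε : Metric.ball ((t₀, 0) : ℝ × ℂ) ε ⊆ φ.2.target) {P Q : ℝ × ℂ}
    (hP : P ∈ Metric.ball ((t₀, 0) : ℝ × ℂ) ε) (hQ : Q ∈ Metric.ball ((t₀, 0) : ℝ × ℂ) ε)
    (hPQ : ‖P.2‖ ≤ ‖Q.2‖ / 2) (hQ0 : Q.2 ≠ 0) (hT : (80 + |φ.1|) * ‖Q.2‖ ≤ Q.1 - P.1) :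
    ∃ c : ℝ → M, 𝒜.IsCausalOn c (Icc 0 1) ∧ c 0 = φ.2.symm P ∧ c 1 = φ.2.symm Q ∧
      ∀ s ∈ Icc (0 : ℝ) 1, ∃ x : ℝ × ℂ, c s = φ.2.symm x ∧ x.1 ∈ Icc P.1 Q.1 ∧
        ‖x.2‖ ≤ ‖Q.2‖ := by
  rw [mem_ball_axis] at hP hQ
  have hQn : 0 < ‖Q.2‖ := norm_pos_iff.mpr hQ0
  have hPQ1 : P.1 ≤ Q.1 := by
    have : 0 ≤ (80 + |φ.1|) * ‖Q.2‖ := by positivity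
    linarith
  have hx : ∀ s ∈ Icc (0 : ℝ) 1, (P.1 + s * (Q.1 - P.1) ∈ Icc P.1 Q.1) ∧
      ‖((‖P.2‖ + s * (‖Q.2‖ - ‖P.2‖) : ℝ) : ℂ) *
        Complex.exp ((P.2.arg + s * (Q.2.arg - P.2.arg) : ℝ) * Complex.I)‖ ≤ ‖Q.2‖ := by
    intro s hs
    refine ⟨⟨by nlinarith [hs.1], by nlinarith [hs.2]⟩, ?_⟩
    rw [norm_mul, Complex.norm_exp_ofReal_mul_I, mul_one, Complex.norm_real, Real.norm_eq_abs,
      abs_le]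
    have := norm_nonneg P.2
    constructor <;> nlinarith [hs.1, hs.2]
  refine ⟨_, isCausalOn_spiral (t := P.1) (T := Q.1 - P.1) (r := ‖P.2‖) (r₁ := ‖Q.2‖)
    (θ := P.2.arg) (δ := Q.2.arg - P.2.arg) hφ hQn (norm_nonneg _) hPQ ?_ hT ?_, ?_, ?_, ?_⟩
  · have h1 := Complex.abs_arg_le_pi P.2
    have h2 := Complex.abs_arg_le_pi Q.2
    rw [abs_le] at *
    constructor <;> linarith [h1.1, h1.2, h2.1, h2.2]
  · intro s hs
    obtain ⟨h1, h2⟩ := hx s hs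
    refine hε (mem_ball_axis.mpr ⟨?_, h2.trans_lt hQ.2⟩)
    have h3 := abs_lt.mp hP.1
    have h4 := abs_lt.mp hQ.1
    rw [abs_lt]
    constructor <;> linarith [h1.1, h1.2]
  · simp [Complex.norm_mul_exp_arg_mul_I]
  · simp only [one_mul, add_sub_cancel]
    rw [Complex.norm_mul_exp_arg_mul_I]
  · exact fun s hs => ⟨_, rfl, hx s hs⟩

theorem reach_outward {φ : ℝ × OpenPartialHomeomorph M (ℝ × ℂ)} (hφ : φ ∈ 𝒜.charts)
    {t₀ ε : ℝ} (hε : Metric.ball ((t₀, 0) : ℝ × ℂ) ε ⊆ φ.2.target) {P Q : ℝ × ℂ}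
    (hP : P ∈ Metric.ball ((t₀, 0) : ℝ × ℂ) ε) (hQ : Q ∈ Metric.ball ((t₀, 0) : ℝ × ℂ) ε)
    (hPQ : ‖P.2‖ ≤ ‖Q.2‖ / 2) (hQ0 : Q.2 ≠ 0) (hT : (80 + |φ.1|) * ‖Q.2‖ ≤ Q.1 - P.1) :
    𝒜.Reach (φ.2.symm P) (φ.2.symm Q) := by
  obtain ⟨c, hc, h0, h1, -⟩ := exists_outward hφ hε hP hQ hPQ hQ0 hT
  exact ⟨c, hc, h0, h1⟩

/-- Through each point runs a causal curve whose points are in the future, resp. in the past, of a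
neighborhood of the given point. At a regular point it is a timelike segment. At a singular point,
it runs along the axis in the past and leaves the axis in the future. -/
theorem exists_chronological (q : M) : ∃ c₁ c₂ : ℝ → M, 𝒜.IsCausalOn c₁ (Icc 0 1) ∧
    𝒜.IsCausalOn c₂ (Icc 0 1) ∧ c₁ 1 = q ∧ c₂ 0 = q ∧
    (∀ s ∈ Ico (0 : ℝ) 1, ∀ᶠ q' in 𝓝 q, 𝒜.Reach (c₁ s) q') ∧
    (∀ s ∈ Ioc (0 : ℝ) 1, ∀ᶠ q' in 𝓝 q, 𝒜.Reach q' (c₂ s)) := by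
  obtain ⟨φ, hφ, hq⟩ := 𝒜.cover q
  set x := φ.2 q with hx
  have hqx : φ.2.symm x = q := φ.2.left_inv hq
  -- neighborhoods of `q` are read in the chart
  have hev : ∀ P : M → Prop, (∀ᶠ y in 𝓝 x, P (φ.2.symm y)) → ∀ᶠ q' in 𝓝 q, P q' := by
    intro P hP
    have := (φ.2.continuousAt hq).eventually hP
    filter_upwards [this, φ.2.open_source.mem_nhds hq] with q' h1 h2
    rwa [φ.2.left_inv h2] at h1
  by_cases hreg : x ∈ modelReg φ.1
  · obtain ⟨v, hv, hv1⟩ := exists_timelike hreg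
    have hopen : ∀ᶠ p in 𝓝 (x, v), ds2 φ.1 p.1 p.2 < 0 ∧ 0 < p.2.1 ∧
        p.1 ∈ modelReg φ.1 ∩ φ.2.target := by
      have h1 := (continuousAt_ds2 hreg v).eventually_lt continuousAt_const hv
      have h2 : ∀ᶠ p in 𝓝 (x, v), 0 < p.2.1 :=
        (continuous_fst.comp continuous_snd).continuousAt.eventually (lt_mem_nhds hv1)
      have h3 : ∀ᶠ p in 𝓝 (x, v), p.1 ∈ modelReg φ.1 ∩ φ.2.target :=
        continuous_fst.continuousAt.eventually (((isOpen_modelReg φ.1).inter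
          φ.2.open_target).mem_nhds ⟨hreg, φ.2.map_source hq⟩)
      filter_upwards [h1, h2, h3] with p h1 h2 h3 using ⟨h1, h2, h3⟩
    obtain ⟨δ, hδ, hball⟩ := Metric.eventually_nhds_iff_ball.mp hopen
    have hline : ∀ P ∈ Metric.ball x δ, ∀ h > (0 : ℝ), ∀ w ∈ Metric.ball v δ,
        P + h • w ∈ Metric.ball x δ →
        𝒜.IsCausalOn (fun s => φ.2.symm (P + (s * h) • w)) (Icc 0 1) := by
      intro P hP h hh w hw hQ
      have hmem : ∀ s ∈ Icc (0 : ℝ) 1, P + (s * h) • w ∈ Metric.ball x δ := by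
        intro s hs
        have := (convex_ball x δ).add_smul_sub_mem hP hQ hs
        rwa [add_sub_cancel_left, smul_smul] at this
      have hb : ∀ y ∈ Metric.ball x δ, ds2 φ.1 y w < 0 ∧ 0 < w.1 ∧
          y ∈ modelReg φ.1 ∩ φ.2.target := by
        intro y hy
        refine hball (y, w) ?_
        rw [← ball_prod_same]
        exact ⟨hy, hw⟩
      refine isCausalOn_of_chart hφ (by fun_prop)
        (fun s hs => (hb _ (hmem s hs)).2.2.2) fun s hs => ?_
      have hs' := hb _ (hmem s (Ioo_subset_Icc_self hs))
      refine ⟨hs'.2.2.1, h • w, ?_, FutureCausal.smul ⟨hs'.1.le, hs'.2.1⟩ hh⟩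
      have h1 : HasDerivAt (fun s : ℝ => s * h) h s := by
        simpa using (hasDerivAt_id s).mul_const h
      exact (h1.smul_const w).const_add P
    have hreach : ∀ P ∈ Metric.ball x δ, ∀ Q ∈ Metric.ball x δ, ∀ h > (0 : ℝ),
        h⁻¹ • (Q - P) ∈ Metric.ball v δ → 𝒜.Reach (φ.2.symm P) (φ.2.symm Q) := by
      intro P hP Q hQ h hh hw
      have h1 : P + h • h⁻¹ • (Q - P) = Q := by
        rw [smul_inv_smul₀ hh.ne', add_sub_cancel]
      have := (hline P hP h hh _ hw (by rwa [h1])).reach one_pos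
      simpa only [zero_mul, zero_smul, add_zero, one_mul, h1] using this
    obtain ⟨η, hη, hηδ⟩ : ∃ η > 0, ∀ s : ℝ, |s| ≤ η → x + s • v ∈ Metric.ball x δ := by
      refine ⟨δ / (2 * (‖v‖ + 1)), by positivity, fun s hs => ?_⟩
      rw [Metric.mem_ball, dist_self_add_left, norm_smul, Real.norm_eq_abs]
      calc |s| * ‖v‖ ≤ δ / (2 * (‖v‖ + 1)) * (‖v‖ + 1) := by gcongr; linarith
        _ = δ / 2 := by field_simp
        _ < δ := by linarith
    have hxb : x ∈ Metric.ball x δ := Metric.mem_ball_self hδ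
    have hvb : v ∈ Metric.ball v δ := Metric.mem_ball_self hδ
    have e1 : ∀ s : ℝ, x + (-η) • v + (s * η) • v = x + ((s - 1) * η) • v := by
      intro s; module
    refine ⟨fun s => φ.2.symm (x + (-η) • v + (s * η) • v), fun s => φ.2.symm (x + (s * η) • v),
      hline _ (hηδ _ (by rw [abs_neg, abs_of_pos hη])) η hη v hvb (by simpa using hxb),
      hline x hxb η hη v hvb (hηδ _ (abs_of_pos hη).le), by simpa using hqx,
      by simpa using hqx, ?_, ?_⟩
    · intro s hs
      have hs1 : 0 < (1 - s) * η := mul_pos (by linarith [hs.2]) hη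
      have hc : ContinuousAt (fun y => ((1 - s) * η)⁻¹ • (y - (x + (-η) • v + (s * η) • v))) x := by
        fun_prop
      have hcx : ((1 - s) * η)⁻¹ • (x - (x + (-η) • v + (s * η) • v)) = v := by
        rw [e1, show x - (x + ((s - 1) * η) • v) = ((1 - s) * η) • v by module,
          inv_smul_smul₀ hs1.ne']
      refine hev (fun q' => 𝒜.Reach _ q') ?_
      filter_upwards [Metric.ball_mem_nhds x hδ, hc.preimage_mem_nhds
        (by rw [hcx]; exact Metric.ball_mem_nhds v hδ)] with y hy hy2
      refine hreach _ ?_ y hy _ hs1 hy2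
      rw [e1]
      refine hηδ _ ?_
      rw [abs_le]; constructor <;> nlinarith [hs.1, hs.2]
    · intro s hs
      have hs1 : 0 < s * η := mul_pos hs.1 hη
      have hc : ContinuousAt (fun y => (s * η)⁻¹ • (x + (s * η) • v - y)) x := by
        fun_prop
      have hcx : (s * η)⁻¹ • (x + (s * η) • v - x) = v := by
        rw [add_sub_cancel_left, inv_smul_smul₀ hs1.ne']
      refine hev (fun q' => 𝒜.Reach q' _) ?_
      filter_upwards [Metric.ball_mem_nhds x hδ, hc.preimage_mem_nhds
        (by rw [hcx]; exact Metric.ball_mem_nhds v hδ)] with y hy hy2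
      refine hreach y hy _ (hηδ _ ?_) _ hs1 hy2
      rw [abs_of_pos hs1]; nlinarith [hs.2]
  · simp only [modelReg, mem_ofPred_eq, not_or, not_not] at hreg
    set t₀ := x.1
    have hx0 : x = (t₀, 0) := Prod.ext rfl hreg.1
    obtain ⟨ε, hε, hball⟩ := Metric.isOpen_iff.mp φ.2.open_target x (φ.2.map_source hq)
    rw [hx0] at hball hqx hev
    set K := 80 + |φ.1| with hK
    have hKp : 80 ≤ K := by have := abs_nonneg φ.1; linarith
    -- the radius reached by the second curve, whose slope is `2 * K`
    set ρ := ε / (4 * K) with hρ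
    have hρp : 0 < ρ := by positivity
    have hKρ : 4 * (K * ρ) = ε := by rw [hρ]; field_simp
    have hρK : 80 * ρ ≤ K * ρ := by gcongr
    have hm : ∀ s ∈ Icc (0 : ℝ) 1, ((t₀ + s * (2 * (K * ρ)), ((0 + s * (ρ - 0) : ℝ) : ℂ) *
        Complex.exp ((0 + s * 0 : ℝ) * Complex.I)) : ℝ × ℂ) ∈ Metric.ball (t₀, 0) ε := by
      intro s hs
      rw [mem_ball_axis, norm_mul, Complex.norm_exp_ofReal_mul_I, Complex.norm_real]
      simp only [add_sub_cancel_left, zero_add, sub_zero, mul_one, Real.norm_eq_abs]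
      rw [abs_of_nonneg (by have := hs.1; positivity), abs_of_nonneg (by have := hs.1; positivity)]
      constructor <;> nlinarith [hs.1, hs.2]
    have hm1 : ∀ s ∈ Icc (0 : ℝ) 1,
        ((t₀ - ε / 2 + s * (ε / 2), 0) : ℝ × ℂ) ∈ Metric.ball (t₀, 0) ε := by
      intro s hs
      rw [mem_ball_axis, abs_lt]
      refine ⟨?_, by simpa using hε⟩
      constructor <;> simp only <;> nlinarith [hs.1, hs.2]
    refine ⟨_, _, isCausalOn_vertical (t := t₀ - ε / 2) (z := 0) hφ (half_pos hε)
        fun s hs => hball (hm1 s hs),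
      isCausalOn_spiral (t := t₀) (T := 2 * (K * ρ)) (r := 0) (r₁ := ρ) (θ := 0) (δ := 0) hφ hρp
        le_rfl (by positivity) (by simp; positivity) (by nlinarith) fun s hs => hball (hm s hs),
      by simpa using hqx, by simpa using hqx, ?_, ?_⟩
    · intro s hs
      refine hev (fun q' => 𝒜.Reach _ q') ?_
      have hs1 : 0 < (1 - s) * (ε / 2) := mul_pos (by linarith [hs.2]) (by positivity)
      have hc1 : ContinuousAt (fun y : ℝ × ℂ => y.1 - K * ‖y.2‖) (t₀, 0) := by fun_prop
      filter_upwards [Metric.ball_mem_nhds _ hε, hc1.eventually_const_lt (u := t₀ -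
        (1 - s) * (ε / 2)) (by simp only [norm_zero, mul_zero, sub_zero]; linarith)] with y hy hy1
      by_cases hy0 : y.2 = 0
      · rw [hy0, norm_zero, mul_zero, sub_zero] at hy1
        rw [show y = (y.1, 0) from Prod.ext rfl hy0]
        refine reach_vertical hφ (by linarith) fun t ht => hball ?_
        have h1 := mem_ball_axis.mp (hm1 s ⟨hs.1, hs.2.le⟩)
        have h2 := mem_ball_axis.mp hy
        simp only [abs_lt] at h1 h2
        rw [mem_ball_axis, abs_lt]
        exact ⟨⟨by linarith [ht.1], by linarith [ht.2]⟩, by simpa using hε⟩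
      · refine reach_outward hφ hball (hm1 s ⟨hs.1, hs.2.le⟩) hy (by simp; positivity) hy0 ?_
        simp only
        nlinarith
    · intro s hs
      refine hev (fun q' => 𝒜.Reach q' _) ?_
      have hsρ : 0 < s * ρ := mul_pos hs.1 hρp
      have hsK : 0 < K * (s * ρ) := by positivity
      have hc1 : ContinuousAt (fun y : ℝ × ℂ => y.1) (t₀, 0) := by fun_prop
      have hc2 : ContinuousAt (fun y : ℝ × ℂ => ‖y.2‖) (t₀, 0) := by fun_prop
      filter_upwards [Metric.ball_mem_nhds _ hε,
        hc1.eventually_lt_const (u := t₀ + K * (s * ρ)) (by simpa using hsK),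
        hc2.eventually_lt_const (u := s * ρ / 2) (by simpa using half_pos hsρ)] with y hy h1 h2
      have hn : ‖((0 + s * (ρ - 0) : ℝ) : ℂ) * Complex.exp ((0 + s * 0 : ℝ) * Complex.I)‖ =
          s * ρ := by
        rw [norm_mul, Complex.norm_exp_ofReal_mul_I, Complex.norm_real, Real.norm_eq_abs]
        simp only [zero_add, sub_zero, mul_one, abs_of_pos hsρ]
      refine reach_outward hφ hball hy (hm s ⟨hs.1.le, hs.2⟩) ?_ ?_ ?_
      · simp only [hn]; exact h2.le
      · simp only [← norm_pos_iff, hn]; exact hsρ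
      · simp only [hn]; nlinarith

/-- If `q` is in the closure of `S`, a point of `S` on the curve of `exists_chronological` through
`q`, other than `q`, would be causally related to points of `S` close to `q`. -/
theorem IsCauchySurface.isClosed [SecondCountableTopology M] {S : Set M}
    (hS : 𝒜.IsCauchySurface S) : IsClosed S := by
  refine isClosed_of_closure_subset fun q hq => ?_
  obtain ⟨c₁, c₂, h₁, h₂, e₁, e₂, hp, hf⟩ := exists_chronological (𝒜 := 𝒜) q
  rw [mem_closure_iff_frequently] at hq
  have hex : ∀ P : M → Prop, (∀ᶠ q' in 𝓝 q, P q') → ∃ q' ∈ S, P q' := by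
    intro P hP
    obtain ⟨q', h1, h2⟩ := (hq.and_eventually hP).exists
    exact ⟨q', h1, h2⟩
  obtain ⟨m, hm, h | ⟨s, hs, rfl⟩ | ⟨s, hs, rfl⟩ | h⟩ := hS.exists_mem h₁ h₂ (e₁.trans e₂.symm)
  · obtain ⟨q', hq', h'⟩ := hex _ (hp 0 (by simp))
    exact absurd (h.trans h') (hS.not_reach hm hq')
  · rcases hs.2.lt_or_eq with h | rfl
    · obtain ⟨q', hq', h'⟩ := hex _ (hp s ⟨hs.1, h⟩)
      exact absurd h' (hS.not_reach hm hq')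
    · rwa [← e₁]
  · rcases hs.1.lt_or_eq with h | rfl
    · obtain ⟨q', hq', h'⟩ := hex _ (hf s ⟨h, hs.2⟩)
      exact absurd h' (hS.not_reach hq' hm)
    · rwa [← e₂]
  · obtain ⟨q', hq', h'⟩ := hex _ (hf 1 (by simp))
    exact absurd (h'.trans h) (hS.not_reach hq' hm)

/-! ### A Cauchy surface is a graph near its singular points -/

theorem IsCauchySurface.eq_of_vertical [SecondCountableTopology M] {S : Set M}
    (hS : 𝒜.IsCauchySurface S) {φ : ℝ × OpenPartialHomeomorph M (ℝ × ℂ)} (hφ : φ ∈ 𝒜.charts)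
    {t₀ ε : ℝ} (hε : Metric.ball ((t₀, 0) : ℝ × ℂ) ε ⊆ φ.2.target) {t t' : ℝ} {z : ℂ}
    (ht : (t, z) ∈ Metric.ball ((t₀, 0) : ℝ × ℂ) ε)
    (ht' : (t', z) ∈ Metric.ball ((t₀, 0) : ℝ × ℂ) ε)
    (h : φ.2.symm (t, z) ∈ S) (h' : φ.2.symm (t', z) ∈ S) : t = t' := by
  wlog hlt : t < t' generalizing t t'
  · rcases (not_lt.mp hlt).lt_or_eq with h1 | h1
    · exact (this ht' ht h' h h1).symm
    · exact h1.symm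
  refine absurd (reach_vertical hφ hlt fun s hs => hε ?_) (hS.not_reach h h')
  rw [mem_ball_axis] at *
  simp only [abs_lt] at *
  exact ⟨⟨by linarith [hs.1], by linarith [hs.2]⟩, ht.2⟩

/-- A vertical segment close to a singular point of a Cauchy surface meets the surface: otherwise
so would not the causal curves that run up the axis, go out to this segment and follow it. -/
theorem IsCauchySurface.exists_graph [SecondCountableTopology M] {S : Set M}
    (hS : 𝒜.IsCauchySurface S) {φ : ℝ × OpenPartialHomeomorph M (ℝ × ℂ)} (hφ : φ ∈ 𝒜.charts)
    {p : M} (hp : p ∈ S) (hpφ : p ∈ φ.2.source) {t₀ : ℝ} (hpt : φ.2 p = (t₀, 0)) {ε : ℝ}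
    (hε : 0 < ε) (hball : Metric.ball ((t₀, 0) : ℝ × ℂ) ε ⊆ φ.2.target) :
    ∃ ρ > 0, ρ ≤ ε ∧ ∀ z : ℂ, ‖z‖ < ρ → ∃ t, |t - t₀| < ε ∧ φ.2.symm (t, z) ∈ S := by
  have hpt' : φ.2.symm (t₀, 0) = p := by rw [← hpt, φ.2.left_inv hpφ]
  set a : ℝ × ℂ := (t₀ - ε / 2, 0) with ha
  have hab : a ∈ Metric.ball ((t₀, 0) : ℝ × ℂ) ε := by
    rw [mem_ball_axis, abs_lt]
    refine ⟨?_, by simpa [ha] using hε⟩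
    simp only [ha]
    constructor <;> linarith
  have hap : 𝒜.Reach (φ.2.symm a) p := by
    rw [← hpt']
    refine reach_vertical hφ (by linarith) fun s hs => hball ?_
    rw [mem_ball_axis, abs_lt]
    exact ⟨⟨by linarith [hs.1], by linarith [hs.2]⟩, by simpa using hε⟩
  have haS : φ.2.symm a ∉ S := fun h => hS.not_reach h hp hap
  obtain ⟨η, hη, hηball⟩ : ∃ η > 0, ∀ y ∈ Metric.ball a η, φ.2.symm y ∉ S := by
    have h1 := (φ.2.continuousAt_symm (hball hab)).eventually
      (hS.isClosed.isOpen_compl.mem_nhds haS)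
    exact Metric.eventually_nhds_iff_ball.mp h1
  set K := 80 + |φ.1| with hK
  have hKp : 80 ≤ K := by have := abs_nonneg φ.1; linarith
  refine ⟨min η (ε / 2) / K, by positivity, ?_, ?_⟩
  · rw [div_le_iff₀ (by positivity)]
    have := min_le_right η (ε / 2)
    nlinarith
  intro z hz
  rw [lt_div_iff₀ (by positivity), mul_comm] at hz
  have hz1 : K * ‖z‖ < η := hz.trans_le (min_le_left _ _)
  have hz2 : K * ‖z‖ < ε / 2 := hz.trans_le (min_le_right _ _)
  have hzK : ‖z‖ ≤ K * ‖z‖ := le_mul_of_one_le_left (norm_nonneg z) (by linarith)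
  by_cases hz0 : z = 0
  · subst hz0
    exact ⟨t₀, by simpa using hε, by rwa [hpt']⟩
  have hmem : ∀ t, |t - t₀| < ε → (t, z) ∈ Metric.ball ((t₀, 0) : ℝ × ℂ) ε := fun t ht => by
    rw [mem_ball_axis]; exact ⟨ht, by simp only; linarith⟩
  have hn := norm_nonneg z
  obtain ⟨c₁, h₁, e₀, e₁, hc₁⟩ := exists_outward (𝒜 := 𝒜) hφ hball hab
    (hmem (t₀ - ε / 2 + K * ‖z‖) (by rw [abs_lt]; constructor <;> linarith))
    (by simp [ha]; positivity)
    hz0 (by simp [ha, ← hK])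
  have hh : 0 < ε - K * ‖z‖ := by linarith
  have hvert : ∀ s ∈ Icc (0 : ℝ) 1,
      |t₀ - ε / 2 + K * ‖z‖ + s * (ε - K * ‖z‖) - t₀| < ε := by
    intro s hs
    rw [abs_lt]
    constructor <;> nlinarith [hs.1, hs.2]
  have h₂ := isCausalOn_vertical (t := t₀ - ε / 2 + K * ‖z‖) (z := z) hφ hh
    fun s hs => hball (hmem _ (hvert s hs))
  obtain ⟨m, hm, h | ⟨s, hs, rfl⟩ | ⟨s, hs, rfl⟩ | h⟩ := hS.exists_mem h₁ h₂ (by simpa using e₁)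
  · rw [e₀] at h
    exact absurd (h.trans hap) (hS.not_reach hm hp)
  · obtain ⟨y, hy, hy1, hy2⟩ := hc₁ s hs
    rw [hy] at hm
    refine absurd hm (hηball y ?_)
    simp only [ha] at hy1 hy2 ⊢
    rw [mem_ball_axis, abs_lt]
    exact ⟨⟨by linarith [hy1.1], by linarith [hy1.2]⟩, by linarith⟩
  · exact ⟨_, hvert s hs, hm⟩
  · refine absurd (Reach.trans ?_ h) (hS.not_reach hp hm)
    rw [← hpt']
    refine reach_outward hφ hball (by rw [mem_ball_axis]; simpa using hε)
      (hmem _ (hvert 1 (by simp))) (by simp; positivity) hz0 ?_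
    simp only
    linarith

/-- Near a singular point, a Cauchy surface is the graph of a continuous function. -/
theorem IsCauchySurface.exists_continuous_graph [SecondCountableTopology M] {S : Set M}
    (hS : 𝒜.IsCauchySurface S) {φ : ℝ × OpenPartialHomeomorph M (ℝ × ℂ)} (hφ : φ ∈ 𝒜.charts)
    {p : M} (hp : p ∈ S) (hpφ : p ∈ φ.2.source) {t₀ : ℝ} (hpt : φ.2 p = (t₀, 0)) {ε : ℝ}
    (hε : 0 < ε) (hball : Metric.ball ((t₀, 0) : ℝ × ℂ) ε ⊆ φ.2.target) :
    ∃ ρ > 0, ρ ≤ ε ∧ ∃ f : ℂ → ℝ, ContinuousOn f (Metric.ball 0 ρ) ∧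
      (∀ z ∈ Metric.ball (0 : ℂ) ρ, |f z - t₀| < ε ∧ φ.2.symm (f z, z) ∈ S) ∧
      ∀ z ∈ Metric.ball (0 : ℂ) ρ, ∀ t, |t - t₀| < ε → φ.2.symm (t, z) ∈ S → t = f z := by
  -- work with half the radius, so that closed segments stay in the domain of the chart
  obtain ⟨ρ, hρ, hρε, hex⟩ := hS.exists_graph hφ hp hpφ hpt (half_pos hε)
    ((Metric.ball_subset_ball (by linarith)).trans hball)
  choose! f hf using hex
  have hmem : ∀ z : ℂ, ‖z‖ < ρ → ∀ t, |t - t₀| < ε →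
      (t, z) ∈ Metric.ball ((t₀, 0) : ℝ × ℂ) ε := fun z hz t ht => by
    rw [mem_ball_axis]; exact ⟨ht, by simp only; linarith⟩
  have huniq : ∀ z : ℂ, ‖z‖ < ρ → ∀ t, |t - t₀| < ε → φ.2.symm (t, z) ∈ S → t = f z := by
    intro z hz t ht hts
    exact hS.eq_of_vertical hφ hball (hmem z hz t ht)
      (hmem z hz _ ((hf z hz).1.trans (by linarith))) hts (hf z hz).2
  refine ⟨ρ, hρ, by linarith, f, ?_, ?_, ?_⟩
  · intro z hz
    rw [mem_ball_zero_iff] at hz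
    refine ContinuousAt.continuousWithinAt ?_
    rw [Metric.continuousAt_iff']
    intro η hη
    set C : Set ℝ := Metric.closedBall t₀ (ε / 2) \ Metric.ball (f z) η with hC
    have hCc : IsCompact C := (isCompact_closedBall _ _).diff Metric.isOpen_ball
    have hP : ∀ t ∈ C, ∀ᶠ y : ℂ × ℝ in 𝓝 (z, t), φ.2.symm (y.2, y.1) ∉ S := by
      intro t ht
      have ht1 : |t - t₀| < ε := by
        have := Metric.mem_closedBall.mp ht.1
        rw [Real.dist_eq] at this
        linarith
      have hnot : φ.2.symm (t, z) ∉ S := fun h => by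
        refine ht.2 ?_
        rw [huniq z hz t ht1 h]
        exact Metric.mem_ball_self hη
      have hc : ContinuousAt (fun y : ℂ × ℝ => φ.2.symm (y.2, y.1)) (z, t) :=
        ContinuousAt.comp (g := φ.2.symm) (φ.2.continuousAt_symm (hball (hmem z hz t ht1)))
          (by fun_prop)
      exact hc.eventually (hS.isClosed.isOpen_compl.mem_nhds hnot)
    filter_upwards [hCc.eventually_forall_of_forall_eventually
      (P := fun w t => φ.2.symm (t, w) ∉ S) hP,
      Metric.isOpen_ball.mem_nhds (mem_ball_zero_iff.mpr hz)] with w hw hwρ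
    by_contra hfw
    rw [mem_ball_zero_iff] at hwρ
    refine hw (f w) ⟨?_, hfw⟩ (hf w hwρ).2
    rw [Metric.mem_closedBall, Real.dist_eq]
    exact (hf w hwρ).1.le
  · intro z hz
    rw [mem_ball_zero_iff] at hz
    exact ⟨(hf z hz).1.trans (by linarith), (hf z hz).2⟩
  · intro z hz
    exact huniq z (mem_ball_zero_iff.mp hz)

end Atlas

/-! ### The Riemannian distance -/

namespace Atlas

variable {A : Set ℝ} {M : Type*} [TopologicalSpace M] {𝒜 : Atlas A M}

variable (𝒜) in
/-- `γ` is a `C¹` curve on `[a, b]`, as read in charts. -/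
def IsC1On (γ : ℝ → M) (a b : ℝ) : Prop :=
  ∀ s ∈ Icc a b, ∃ φ ∈ 𝒜.charts, γ s ∈ φ.2.source ∧
    ContDiffWithinAt ℝ 1 (fun s' => φ.2 (γ s')) (Icc a b) s

theorem IsC1On.comp_affine {γ : ℝ → M} {a b a' b' k m : ℝ} (h : 𝒜.IsC1On γ a b)
    (hm : MapsTo (fun s => k * s + m) (Icc a' b') (Icc a b)) :
    𝒜.IsC1On (fun s => γ (k * s + m)) a' b' := by
  intro s hs
  obtain ⟨φ, hφ, hsφ, hd⟩ := h _ (hm hs)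
  refine ⟨φ, hφ, hsφ, ?_⟩
  exact hd.comp s (g := fun s' => φ.2 (γ s')) (f := fun s => k * s + m)
    (ContDiff.contDiffWithinAt (by fun_prop)) hm

theorem IsC1On.congr {γ γ' : ℝ → M} {a b : ℝ} (h : 𝒜.IsC1On γ a b)
    (hγ : EqOn γ' γ (Icc a b)) : 𝒜.IsC1On γ' a b := by
  intro s hs
  obtain ⟨φ, hφ, hsφ, hd⟩ := h s hs
  refine ⟨φ, hφ, by rwa [hγ hs], hd.congr (fun t ht => by rw [hγ ht]) (by rw [hγ hs])⟩

theorem speed_comp_affine (γ : ℝ → M) (k m s : ℝ) :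
    𝒜.speed (fun s => γ (k * s + m)) s = |k| * 𝒜.speed γ (k * s + m) := by
  unfold speed
  set φ := 𝒜.chartAt (γ (k * s + m))
  have h1 : deriv (fun s' => φ.2 (γ (k * s' + m))) s =
      k • deriv (fun s' => φ.2 (γ s')) (k * s + m) := by
    have h2 := deriv_comp_mul_left k (fun u => φ.2 (γ (u + m))) s
    rw [deriv_comp_add_const (f := fun u => φ.2 (γ u))] at h2
    exact h2
  rw [h1, ds2_smul, Real.sqrt_mul (sq_nonneg k), Real.sqrt_sq_eq_abs]

theorem speed_congr {γ γ' : ℝ → M} {s : ℝ} (h : γ =ᶠ[𝓝 s] γ') : 𝒜.speed γ s = 𝒜.speed γ' s := by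
  unfold speed
  rw [h.eq_of_nhds]
  congr 2
  exact EventuallyEq.deriv_eq (h.fun_comp _)

theorem lintegral_speed_comp_affine (γ : ℝ → M) {k : ℝ} (hk : k ≠ 0) (m : ℝ) {I : Set ℝ}
    (hI : MeasurableSet I) :
    ∫⁻ s in I, ENNReal.ofReal (𝒜.speed (fun s => γ (k * s + m)) s) =
      ∫⁻ s in (fun s => k * s + m) '' I, ENNReal.ofReal (𝒜.speed γ s) := by
  have hd : ∀ s ∈ I, HasDerivWithinAt (fun s : ℝ => k * s + m) k I s := fun s _ => by
    simpa using (((hasDerivAt_id s).const_mul k).add_const m).hasDerivWithinAt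
  rw [lintegral_image_eq_lintegral_abs_deriv_mul hI hd]
  · simp_rw [speed_comp_affine, ENNReal.ofReal_mul (abs_nonneg k)]
  · intro a _ b _ hab
    simpa [hk] using hab

theorem regDist_le_length {S : Set M} {γ : ℝ → M} (h : 𝒜.IsPiecewiseC1Curve S γ) :
    𝒜.regDist S (γ 0) (γ 1) ≤ 𝒜.length γ :=
  iInf₂_le γ ⟨h, rfl, rfl⟩

theorem regDist_comm_le (S : Set M) (x y : M) : 𝒜.regDist S y x ≤ 𝒜.regDist S x y := by
  refine le_iInf₂ ?_
  rintro γ ⟨⟨hc, hm, n, t, ht, ht0, htn, hp⟩, rfl, rfl⟩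
  have hI : MapsTo (fun s : ℝ => -1 * s + 1) (Icc 0 1) (Icc 0 1) := fun s hs => by
    constructor <;> simp only <;> linarith [hs.1, hs.2]
  have hrev : 𝒜.IsPiecewiseC1Curve S (fun s => γ (-1 * s + 1)) := by
    refine ⟨hc.comp (by fun_prop) hI, fun s hs => hm _ (hI hs), n, fun i => 1 - t (n - i),
      fun i j hij => sub_le_sub_left (ht (by omega)) 1, by simp [htn], by simp [ht0], ?_⟩
    intro i hi
    have hi' := hp (n - (i + 1)) (by omega)
    rw [show n - (i + 1) + 1 = n - i by omega] at hi'
    refine IsC1On.comp_affine (γ := γ) (k := -1) (m := 1) hi' fun s hs => ?_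
    constructor <;> simp only <;> linarith [hs.1, hs.2]
  have h1 := regDist_le_length hrev
  have h2 : 𝒜.length (fun s => γ (-1 * s + 1)) = 𝒜.length γ := by
    unfold length
    rw [lintegral_speed_comp_affine γ (by norm_num) 1 measurableSet_Icc]
    congr 2
    ext s
    constructor
    · rintro ⟨u, hu, rfl⟩; exact hI hu
    · intro hs
      exact ⟨-1 * s + 1, hI hs, by ring⟩
  rw [h2] at h1
  simpa using h1

theorem regDist_comm (S : Set M) (x y : M) : 𝒜.regDist S x y = 𝒜.regDist S y x :=
  le_antisymm (regDist_comm_le S y x) (regDist_comm_le S x y)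

theorem regDist_triangle (S : Set M) (x y z : M) :
    𝒜.regDist S x z ≤ 𝒜.regDist S x y + 𝒜.regDist S y z := by
  have key : ∀ γ₁ γ₂ : ℝ → M, 𝒜.IsPiecewiseC1Curve S γ₁ → 𝒜.IsPiecewiseC1Curve S γ₂ →
      γ₁ 1 = γ₂ 0 → 𝒜.regDist S (γ₁ 0) (γ₂ 1) ≤ 𝒜.length γ₁ + 𝒜.length γ₂ := by
    rintro γ₁ γ₂ ⟨hc₁, hm₁, n₁, t₁, ht₁, ht0₁, htn₁, hp₁⟩ ⟨hc₂, hm₂, n₂, t₂, ht₂, ht0₂, htn₂, hp₂⟩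
      h₁₂
    set c : ℝ → M := fun s => if s ≤ 1 / 2 then γ₁ (2 * s + 0) else γ₂ (2 * s + (-1)) with hc
    have e₁ : EqOn c (fun s => γ₁ (2 * s + 0)) (Iic (1 / 2)) := fun s hs => if_pos hs
    have e₂ : EqOn c (fun s => γ₂ (2 * s + (-1))) (Ici (1 / 2)) := by
      intro s hs
      rcases (mem_Ici.mp hs).lt_or_eq with h | rfl
      · exact if_neg (not_le.mpr h)
      · simp only [hc, le_refl, if_true]
        norm_num [h₁₂]
    have hI₁ : MapsTo (fun s : ℝ => 2 * s + 0) (Icc 0 (1 / 2)) (Icc 0 1) := fun s hs => by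
      constructor <;> simp only <;> linarith [hs.1, hs.2]
    have hI₂ : MapsTo (fun s : ℝ => 2 * s + (-1)) (Icc (1 / 2) 1) (Icc 0 1) := fun s hs => by
      constructor <;> simp only <;> linarith [hs.1, hs.2]
    have hU : Icc (0 : ℝ) (1 / 2) ∪ Icc (1 / 2) 1 = Icc 0 1 :=
      Icc_union_Icc_eq_Icc (by norm_num) (by norm_num)
    have ht₁' : ∀ i ≤ n₁, t₁ i ≤ 1 := fun i hi => htn₁ ▸ ht₁ hi
    have ht₂' : ∀ i, 0 ≤ t₂ i := fun i => ht0₂ ▸ ht₂ (Nat.zero_le i)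
    have hcurve : 𝒜.IsPiecewiseC1Curve S c := by
      refine ⟨?_, ?_, n₁ + n₂, fun i => if i ≤ n₁ then t₁ i / 2 else 1 / 2 + t₂ (i - n₁) / 2,
        ?_, ?_, ?_, ?_⟩
      · rw [← hU]
        refine ContinuousOn.union_of_isClosed ?_ ?_ isClosed_Icc isClosed_Icc
        · exact (hc₁.comp (by fun_prop) hI₁).congr (e₁.mono Icc_subset_Iic_self)
        · exact (hc₂.comp (by fun_prop) hI₂).congr (e₂.mono Icc_subset_Ici_self)
      · intro s hs
        rw [← hU] at hs
        rcases hs with hs | hs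
        · rw [e₁ hs.2]; exact hm₁ _ (hI₁ hs)
        · rw [e₂ hs.1]; exact hm₂ _ (hI₂ hs)
      · refine monotone_nat_of_le_succ fun i => ?_
        rcases lt_trichotomy i n₁ with h | rfl | h
        · rw [if_pos h.le, if_pos (by omega)]
          linarith [ht₁ (Nat.le_succ i)]
        · rw [if_pos le_rfl, if_neg (by omega), htn₁]
          linarith [ht₂' (i + 1 - i)]
        · rw [if_neg (by omega), if_neg (by omega), show i + 1 - n₁ = i - n₁ + 1 by omega]
          linarith [ht₂ (Nat.le_succ (i - n₁))]
      · simp [ht0₁]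
      · by_cases h : n₂ = 0
        · subst h; exact absurd (ht0₂.symm.trans htn₂) (by norm_num)
        · beta_reduce
          rw [if_neg (by omega), show n₁ + n₂ - n₁ = n₂ by omega, htn₂]; norm_num
      · intro i hi
        beta_reduce
        rcases lt_or_ge i n₁ with h | h
        · rw [if_pos h.le, if_pos (show i + 1 ≤ n₁ by omega)]
          have h1 := ht₁' (i + 1) h
          refine IsC1On.congr (IsC1On.comp_affine (γ := γ₁) (k := 2) (m := 0) (hp₁ i h) ?_) ?_
          · intro s hs
            constructor <;> simp only <;> linarith [hs.1, hs.2]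
          · exact e₁.mono fun s hs => mem_Iic.mpr (by linarith [hs.2])
        · have hti : (if i ≤ n₁ then t₁ i / 2 else 1 / 2 + t₂ (i - n₁) / 2) =
              1 / 2 + t₂ (i - n₁) / 2 := by
            rcases h.lt_or_eq with h | rfl
            · rw [if_neg (by omega)]
            · rw [if_pos le_rfl, htn₁, Nat.sub_self, ht0₂]; norm_num
          rw [hti, if_neg (show ¬ i + 1 ≤ n₁ by omega),
            show i + 1 - n₁ = i - n₁ + 1 by omega]
          refine IsC1On.congr (IsC1On.comp_affine (γ := γ₂) (k := 2) (m := -1)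
            (hp₂ (i - n₁) (by omega)) ?_) ?_
          · intro s hs
            constructor <;> simp only <;> linarith [hs.1, hs.2]
          · exact e₂.mono fun s hs => mem_Ici.mpr (by linarith [hs.1, ht₂' (i - n₁)])
    have h1 := regDist_le_length hcurve
    have h0 : c 0 = γ₁ 0 := by simp [hc]
    have h1' : c 1 = γ₂ 1 := by
      rw [e₂ (show (1 : ℝ) ∈ Ici (1 / 2) by simp only [mem_Ici]; norm_num)]; norm_num
    rw [h0, h1'] at h1
    refine h1.trans ?_
    unfold length
    have hL₁ : ∫⁻ s in Icc (0 : ℝ) (1 / 2), ENNReal.ofReal (𝒜.speed c s) ≤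
        ∫⁻ s in Icc (0 : ℝ) 1, ENNReal.ofReal (𝒜.speed γ₁ s) := by
      calc ∫⁻ s in Icc (0 : ℝ) (1 / 2), ENNReal.ofReal (𝒜.speed c s)
          = ∫⁻ s in Ioo (0 : ℝ) (1 / 2), ENNReal.ofReal (𝒜.speed c s) :=
            (setLIntegral_congr Ioo_ae_eq_Icc).symm
        _ = ∫⁻ s in Ioo (0 : ℝ) (1 / 2),
              ENNReal.ofReal (𝒜.speed (fun s => γ₁ (2 * s + 0)) s) := by
            refine setLIntegral_congr_fun measurableSet_Ioo fun s hs => ?_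
            rw [speed_congr (e₁.eventuallyEq_of_mem (Iic_mem_nhds hs.2))]
        _ = _ := lintegral_speed_comp_affine γ₁ two_ne_zero 0 measurableSet_Ioo
        _ ≤ ∫⁻ s in Icc (0 : ℝ) 1, ENNReal.ofReal (𝒜.speed γ₁ s) :=
            lintegral_mono_set (image_subset_iff.mpr fun s hs => hI₁ (Ioo_subset_Icc_self hs))
    have hL₂ : ∫⁻ s in Icc (1 / 2 : ℝ) 1, ENNReal.ofReal (𝒜.speed c s) ≤
        ∫⁻ s in Icc (0 : ℝ) 1, ENNReal.ofReal (𝒜.speed γ₂ s) := by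
      calc ∫⁻ s in Icc (1 / 2 : ℝ) 1, ENNReal.ofReal (𝒜.speed c s)
          = ∫⁻ s in Ioo (1 / 2 : ℝ) 1, ENNReal.ofReal (𝒜.speed c s) :=
            (setLIntegral_congr Ioo_ae_eq_Icc).symm
        _ = ∫⁻ s in Ioo (1 / 2 : ℝ) 1,
              ENNReal.ofReal (𝒜.speed (fun s => γ₂ (2 * s + (-1))) s) := by
            refine setLIntegral_congr_fun measurableSet_Ioo fun s hs => ?_
            rw [speed_congr (e₂.eventuallyEq_of_mem (Ici_mem_nhds hs.1))]
        _ = _ := lintegral_speed_comp_affine γ₂ two_ne_zero (-1) measurableSet_Ioo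
        _ ≤ ∫⁻ s in Icc (0 : ℝ) 1, ENNReal.ofReal (𝒜.speed γ₂ s) :=
            lintegral_mono_set (image_subset_iff.mpr fun s hs => hI₂ (Ioo_subset_Icc_self hs))
    conv_lhs => rw [← hU]
    exact (lintegral_union_le _ _ _).trans (add_le_add hL₁ hL₂)
  have h1 : ∀ γ₁ : ℝ → M, 𝒜.IsPiecewiseC1Curve S γ₁ ∧ γ₁ 0 = x ∧ γ₁ 1 = y →
      𝒜.regDist S x z ≤ 𝒜.length γ₁ + 𝒜.regDist S y z := by
    rintro γ₁ ⟨h₁, rfl, rfl⟩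
    conv_rhs => rw [regDist]
    simp only [ENNReal.add_iInf]
    refine le_iInf₂ ?_
    rintro γ₂ ⟨h₂, h0, rfl⟩
    exact key γ₁ γ₂ h₁ h₂ h0.symm
  conv_rhs => rw [regDist]
  simp only [ENNReal.iInf_add]
  exact le_iInf₂ h1

end Atlas

/-! ### Comparison of the distance with the Lorentzian chord -/

/-- If the metric at `x` is positive on the image of `L`, then it varies by a factor at most `2`
on the images of the linear maps close to `L`, at points close to `x`. -/
theorem eventually_ds2_apply_le {E : Type*} [NormedAddCommGroup E] [NormedSpace ℝ E]
    [ProperSpace E] {α : ℝ} {x : ℝ × ℂ} (hx : x ∈ modelReg α) {L : E →L[ℝ] ℝ × ℂ}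
    (hL : ∀ w ≠ 0, 0 < ds2 α x (L w)) :
    ∀ᶠ p : (ℝ × ℂ) × (E →L[ℝ] ℝ × ℂ) in 𝓝 (x, L),
      ∀ w, ds2 α p.1 (p.2 w) ≤ 2 * ds2 α x (L w) := by
  have h1 : ∀ w ∈ Metric.sphere (0 : E) 1,
      ∀ᶠ q : ((ℝ × ℂ) × (E →L[ℝ] ℝ × ℂ)) × E in 𝓝 ((x, L), w),
        ds2 α q.1.1 (q.1.2 q.2) < 2 * ds2 α x (L q.2) := by
    intro w hw
    have hw0 : w ≠ 0 := by rintro rfl; simp at hw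
    have c1 : ContinuousAt (fun q : ((ℝ × ℂ) × (E →L[ℝ] ℝ × ℂ)) × E =>
        ds2 α q.1.1 (q.1.2 q.2)) ((x, L), w) :=
      continuousAt_ds2_comp continuous_fst.fst.continuousAt
        (continuous_fst.snd.clm_apply continuous_snd).continuousAt hx
    have c2 : ContinuousAt (fun q : ((ℝ × ℂ) × (E →L[ℝ] ℝ × ℂ)) × E =>
        2 * ds2 α x (L q.2)) ((x, L), w) :=
      (continuousAt_ds2_comp continuousAt_const (L.continuous.comp continuous_snd).continuousAt
        hx).const_mul 2
    refine c1.eventually_lt c2 ?_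
    have := hL w hw0
    simp only
    linarith
  filter_upwards [(isCompact_sphere (0 : E) 1).eventually_forall_of_forall_eventually
    (P := fun p w => ds2 α p.1 (p.2 w) < 2 * ds2 α x (L w)) h1] with p hp w
  by_cases hw : w = 0
  · have h0 : ∀ y : ℝ × ℂ, ds2 α y 0 = 0 := fun y => by simpa using ds2_smul α y 0 0
    simp [hw, h0]
  · have hn : ‖w‖ ≠ 0 := norm_ne_zero_iff.mpr hw
    have h2 := hp (‖w‖⁻¹ • w) (by simp [norm_smul, hn])
    rw [map_smul, map_smul, ds2_smul, ds2_smul] at h2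
    have h3 : 0 < (‖w‖⁻¹) ^ 2 := by positivity
    nlinarith

/-- If the metric is positive on the image of the differential `L` of `F` at `u₀`, then chords of
the image of `F` at `F u₀` are spacelike and comparable with their linearizations. -/
theorem eventually_ds2_sub_ge {E : Type*} [NormedAddCommGroup E] [NormedSpace ℝ E]
    [ProperSpace E] {α : ℝ} {x : ℝ × ℂ} (hx : x ∈ modelReg α) {L : E →L[ℝ] ℝ × ℂ}
    (hL : ∀ w ≠ 0, 0 < ds2 α x (L w)) {F : E → ℝ × ℂ} {K : Set E} {u₀ : E}
    (hF : HasFDerivWithinAt F L K u₀) :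
    ∀ᶠ u in 𝓝[K] u₀, ds2 α x (L (u - u₀)) ≤ 2 * ds2 α x (F u - F u₀) := by
  have h1 : ∀ w ∈ Metric.sphere (0 : E) 1, ∀ᶠ q : (ℝ × ℂ) × E in 𝓝 (0, w),
      ds2 α x (L q.2) < 2 * ds2 α x (L q.2 + q.1) := by
    intro w hw
    have hw0 : w ≠ 0 := by rintro rfl; simp at hw
    have c1 : ContinuousAt (fun q : (ℝ × ℂ) × E => ds2 α x (L q.2)) (0, w) :=
      continuousAt_ds2_comp continuousAt_const (L.continuous.comp continuous_snd).continuousAt hx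
    have c2 : ContinuousAt (fun q : (ℝ × ℂ) × E => 2 * ds2 α x (L q.2 + q.1)) (0, w) :=
      (continuousAt_ds2_comp continuousAt_const
        ((L.continuous.comp continuous_snd).add continuous_fst).continuousAt hx).const_mul 2
    refine c1.eventually_lt c2 ?_
    have := hL w hw0
    simp only [add_zero]
    linarith
  obtain ⟨η, hη, hball⟩ := Metric.eventually_nhds_iff_ball.mp
    ((isCompact_sphere (0 : E) 1).eventually_forall_of_forall_eventually
      (P := fun e w => ds2 α x (L w) < 2 * ds2 α x (L w + e)) h1)
  filter_upwards [hF.isLittleO.def (half_pos hη)] with u hu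
  by_cases hw : u - u₀ = 0
  · have h0 : ds2 α x 0 = 0 := by simpa using ds2_smul α x 0 0
    rw [sub_eq_zero.mp hw]
    simp [h0]
  set w := u - u₀ with hwdef
  have hn : 0 < ‖w‖ := norm_pos_iff.mpr hw
  have h2 := hball (‖w‖⁻¹ • (F u - F u₀ - L w)) ?_ (‖w‖⁻¹ • w) (by simp [norm_smul, hn.ne'])
  · rw [map_smul, ← smul_add, ds2_smul, ds2_smul, add_sub_cancel] at h2
    have h3 : 0 < (‖w‖⁻¹) ^ 2 := by positivity
    nlinarith
  · rw [mem_ball_zero_iff, norm_smul, norm_inv, norm_norm]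
    calc ‖w‖⁻¹ * ‖F u - F u₀ - L w‖ ≤ ‖w‖⁻¹ * (η / 2 * ‖w‖) := by gcongr
      _ = η / 2 := by field_simp
      _ < η := by linarith

namespace Atlas

variable {A : Set ℝ} {M : Type*} [TopologicalSpace M] {𝒜 : Atlas A M}

theorem uniqueDiffOn_triangle (T : Affine.Triangle ℝ (EuclideanSpace ℝ (Fin 2)))
    {U : Set (EuclideanSpace ℝ (Fin 2))} (hU : IsOpen U) :
    UniqueDiffOn ℝ (U ∩ convexHull ℝ (range T.points)) := by
  rw [inter_comm]
  refine UniqueDiffOn.inter (uniqueDiffOn_convex (convex_convexHull ℝ _) ?_) hU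
  rw [interior_convexHull_nonempty_iff_affineSpan_eq_top]
  exact T.independent.affineSpan_eq_top_iff_card_eq_finrank_add_one.mpr (by simp)

/-- The speed of a curve can be computed in any chart. -/
theorem speed_eq {φ : ℝ × OpenPartialHomeomorph M (ℝ × ℂ)} (hφ : φ ∈ 𝒜.charts) {γ : ℝ → M}
    {s : ℝ} (hγ : ContinuousAt γ s) (hs : γ s ∈ φ.2.source) (hreg : φ.2 (γ s) ∈ modelReg φ.1)
    {v : ℝ × ℂ} (hv : HasDerivAt (fun t => φ.2 (γ t)) v s) :
    𝒜.speed γ s = √(ds2 φ.1 (φ.2 (γ s)) v) := by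
  obtain ⟨hψ, hsψ⟩ := (𝒜.cover (γ s)).choose_spec
  have h1 := hasDerivAt_chart_change hφ hψ hγ hs hsψ hreg hv
  have h2 := (𝒜.compatible φ hφ _ hψ _ ⟨hs, hsψ⟩ hreg).isometric v
  unfold speed chartAt
  rw [h1.deriv, ← h2, Function.comp_apply, φ.2.left_inv hs]

/-- Infinitesimally, the distance is at most twice the Lorentzian length of the chord, read in any
chart. Nearby points of a piecewise smooth surface lie in a common triangle of a local
parametrization, and the comparison curve is the segment that joins them there. -/
theorem IsPiecewiseSmoothSpacelike.eventually_regDist_le {S : Set M}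
    (hS : 𝒜.IsPiecewiseSmoothSpacelike S) (x : S) (hx : (x : M) ∈ 𝒜.reg)
    {ψ : ℝ × OpenPartialHomeomorph M (ℝ × ℂ)} (hψ : ψ ∈ 𝒜.charts) (hxψ : (x : M) ∈ ψ.2.source) :
    ∀ᶠ y : S in 𝓝 x, 0 ≤ ds2 ψ.1 (ψ.2 x) (ψ.2 y - ψ.2 x) ∧
      𝒜.regDist S x y ≤ ENNReal.ofReal (2 * √(ds2 ψ.1 (ψ.2 x) (ψ.2 y - ψ.2 x))) := by
  obtain ⟨φ, hφ, κ, hxκ, hκφ, 𝒯, hcover, hT⟩ := hS x hx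
  set u₀ := κ x with hu₀
  have hu₀κ : u₀ ∈ κ.target := κ.map_source hxκ
  have hxu : κ.symm u₀ = x := κ.left_inv hxκ
  obtain ⟨hxφ, hxreg⟩ := hκφ x hxκ
  have hsrc : ∀ u ∈ κ.target, (κ.symm u : M) ∈ φ.2.source ∧
      φ.2 (κ.symm u : M) ∈ modelReg φ.1 := fun u hu => hκφ _ (κ.map_target hu)
  have hcomp := 𝒜.compatible φ hφ ψ hψ x ⟨hxφ, hxψ⟩ hxreg
  have hψreg : ψ.2 (x : M) ∈ modelReg ψ.1 := (mem_reg_iff hψ hxψ).mp hx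
  -- it is enough to argue in each triangle that contains `u₀`
  have main : ∀ T ∈ 𝒯, u₀ ∈ convexHull ℝ (range T.points) →
      ∀ᶠ u in 𝓝[κ.target ∩ convexHull ℝ (range T.points)] u₀,
        0 ≤ ds2 ψ.1 (ψ.2 x) (ψ.2 (κ.symm u : M) - ψ.2 x) ∧
        𝒜.regDist S x (κ.symm u : M) ≤
          ENNReal.ofReal (2 * √(ds2 ψ.1 (ψ.2 x) (ψ.2 (κ.symm u : M) - ψ.2 x))) := by
    intro T hT𝒯 hu₀T
    obtain ⟨hsmooth, hpos⟩ := hT T hT𝒯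
    set K := κ.target ∩ convexHull ℝ (range T.points) with hK
    set F : EuclideanSpace ℝ (Fin 2) → ℝ × ℂ := fun u => φ.2 (κ.symm u : M) with hF
    have hu₀K : u₀ ∈ K := ⟨hu₀κ, hu₀T⟩
    have hFu₀ : F u₀ = φ.2 x := by simp only [hF, hxu]
    have hdiff := hsmooth.differentiableOn (by simp)
    have hcont : ContinuousOn (fderivWithin ℝ F K) K :=
      hsmooth.continuousOn_fderivWithin (uniqueDiffOn_triangle T κ.open_target) (by simp)
    set L := fderivWithin ℝ F K u₀ with hL
    set L' := (fderiv ℝ (ψ.2 ∘ φ.2.symm) (φ.2 x)).comp L with hL'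
    have hLiso : ∀ w, ds2 ψ.1 (ψ.2 x) (L' w) = ds2 φ.1 (φ.2 x) (L w) := by
      intro w
      have := hcomp.isometric (L w)
      rwa [Function.comp_apply, φ.2.left_inv hxφ] at this
    have hLpos : ∀ w ≠ 0, 0 < ds2 φ.1 (φ.2 x) (L w) := by
      intro w hw
      have := hpos u₀ hu₀K w hw
      rwa [hFu₀] at this
    have hLnonneg : ∀ w, 0 ≤ ds2 φ.1 (φ.2 x) (L w) := by
      intro w
      by_cases hw : w = 0
      · have h0 : ds2 φ.1 (φ.2 x) 0 = 0 := by simpa using ds2_smul φ.1 (φ.2 x) 0 0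
        rw [hw, map_zero, h0]
      · exact (hLpos w hw).le
    have hL'pos : ∀ w ≠ 0, 0 < ds2 ψ.1 (ψ.2 x) (L' w) := by
      intro w hw; rw [hLiso]; exact hLpos w hw
    have hF' : HasFDerivWithinAt (fun u => ψ.2 (κ.symm u : M)) L' K u₀ := by
      have h1 : HasFDerivAt (ψ.2 ∘ φ.2.symm) (fderiv ℝ (ψ.2 ∘ φ.2.symm) (φ.2 x)) (F u₀) := by
        rw [hFu₀]
        exact (hcomp.smooth.differentiableAt (by simp)).hasFDerivAt
      refine (h1.comp_hasFDerivWithinAt u₀ (hdiff u₀ hu₀K).hasFDerivWithinAt).congr ?_ ?_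
      · intro u hu
        simp [hF, φ.2.left_inv (hsrc u hu.1).1]
      · simp [hF, φ.2.left_inv (hsrc u₀ hu₀κ).1]
    have hchord := eventually_ds2_sub_ge hψreg hL'pos hF'
    have htend : Tendsto (fun u => (F u, fderivWithin ℝ F K u)) (𝓝[K] u₀) (𝓝 (φ.2 x, L)) := by
      have := (hsmooth.continuousOn.prodMk hcont) u₀ hu₀K
      rwa [ContinuousWithinAt, hFu₀] at this
    have hspeed := htend.eventually (eventually_ds2_apply_le hxreg hLpos)
    obtain ⟨r, hr, hball⟩ := Metric.mem_nhdsWithin_iff.mp hspeed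
    obtain ⟨r', hr', hball'⟩ := Metric.isOpen_iff.mp κ.open_target u₀ hu₀κ
    filter_upwards [hchord, self_mem_nhdsWithin,
      nhdsWithin_le_nhds (Metric.ball_mem_nhds u₀ (lt_min hr hr'))] with u hu huK hur
    rw [hxu, hLiso] at hu
    refine ⟨by linarith [hLnonneg (u - u₀)], ?_⟩
    have hseg : ∀ s ∈ Icc (0 : ℝ) 1, u₀ + s • (u - u₀) ∈ K ∧
        u₀ + s • (u - u₀) ∈ Metric.ball u₀ r := by
      intro s hs
      have h1 := (convex_ball u₀ (min r r')).add_smul_sub_mem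
        (Metric.mem_ball_self (lt_min hr hr')) hur hs
      have h2 := (convex_convexHull ℝ (range T.points)).add_smul_sub_mem hu₀T huK.2 hs
      exact ⟨⟨hball' (Metric.ball_subset_ball (min_le_right _ _) h1), h2⟩,
        Metric.ball_subset_ball (min_le_left _ _) h1⟩
    set γ : ℝ → M := fun s => (κ.symm (u₀ + s • (u - u₀)) : M) with hγ
    have hγc : ContinuousOn γ (Icc 0 1) :=
      continuous_subtype_val.comp_continuousOn
        (κ.continuousOn_symm.comp (by fun_prop) fun s hs => (hseg s hs).1.1)
    have hcurve : 𝒜.IsPiecewiseC1Curve S γ := by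
      refine ⟨hγc, fun s hs => ⟨(κ.symm _).2, φ, hφ, hsrc _ (hseg s hs).1.1⟩, 1,
        fun i => if i = 0 then 0 else 1, ?_, by simp, by simp, ?_⟩
      · refine monotone_nat_of_le_succ fun i => ?_
        by_cases h : i = 0 <;> simp [h]
      · intro i hi
        obtain rfl : i = 0 := by omega
        simp only [if_true, zero_add, one_ne_zero, if_false]
        intro s hs
        refine ⟨φ, hφ, (hsrc _ (hseg s hs).1.1).1, ?_⟩
        exact ((hsmooth _ (hseg s hs).1).of_le (by simp)).comp s
          (f := fun s : ℝ => u₀ + s • (u - u₀))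
          (ContDiff.contDiffWithinAt (by fun_prop)) fun s hs => (hseg s hs).1
    have hγspeed : ∀ s ∈ Ioo (0 : ℝ) 1, 𝒜.speed γ s ≤
        √(2 * ds2 φ.1 (φ.2 x) (L (u - u₀))) := by
      intro s hs
      have hsI := Ioo_subset_Icc_self hs
      have hline : HasDerivWithinAt (fun s : ℝ => u₀ + s • (u - u₀)) (u - u₀) (Icc 0 1) s := by
        simpa using (((hasDerivAt_id s).smul_const (u - u₀)).const_add u₀).hasDerivWithinAt
      have hd := ((hdiff _ (hseg s hsI).1).hasFDerivWithinAt.comp_hasDerivWithinAt s hline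
        fun s hs => (hseg s hs).1).hasDerivAt (Icc_mem_nhds hs.1 hs.2)
      rw [speed_eq hφ (hγc.continuousAt (Icc_mem_nhds hs.1 hs.2)) (hsrc _ (hseg s hsI).1.1).1
        (hsrc _ (hseg s hsI).1.1).2 hd]
      exact Real.sqrt_le_sqrt (hball ⟨(hseg s hsI).2, (hseg s hsI).1⟩ (u - u₀))
    have h1 := regDist_le_length hcurve
    have e0 : γ 0 = x := by simp [hγ, hxu]
    have e1 : γ 1 = κ.symm u := by simp [hγ]
    rw [e0, e1] at h1
    refine h1.trans ?_
    calc 𝒜.length γ = ∫⁻ s in Ioo (0 : ℝ) 1, ENNReal.ofReal (𝒜.speed γ s) :=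
          (setLIntegral_congr Ioo_ae_eq_Icc).symm
      _ ≤ ∫⁻ s in Ioo (0 : ℝ) 1, ENNReal.ofReal (√(2 * ds2 φ.1 (φ.2 x) (L (u - u₀)))) :=
          setLIntegral_mono' measurableSet_Ioo fun s hs =>
            ENNReal.ofReal_le_ofReal (hγspeed s hs)
      _ = ENNReal.ofReal (√(2 * ds2 φ.1 (φ.2 x) (L (u - u₀)))) := by simp
      _ ≤ _ := by
          refine ENNReal.ofReal_le_ofReal ?_
          rw [show (2 : ℝ) = √4 by rw [show (4 : ℝ) = 2 ^ 2 by norm_num]; simp,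
            ← Real.sqrt_mul (by norm_num)]
          refine Real.sqrt_le_sqrt ?_
          rw [show √4 = (2 : ℝ) by rw [show (4 : ℝ) = 2 ^ 2 by norm_num]; simp]
          linarith
  have hnear : ∀ T ∈ 𝒯, ∀ᶠ u in 𝓝 u₀, u ∈ κ.target → u ∈ convexHull ℝ (range T.points) →
      0 ≤ ds2 ψ.1 (ψ.2 x) (ψ.2 (κ.symm u : M) - ψ.2 x) ∧
        𝒜.regDist S x (κ.symm u : M) ≤
          ENNReal.ofReal (2 * √(ds2 ψ.1 (ψ.2 x) (ψ.2 (κ.symm u : M) - ψ.2 x))) := by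
    intro T hT𝒯
    by_cases hu₀T : u₀ ∈ convexHull ℝ (range T.points)
    · have := eventually_nhdsWithin_iff.mp (main T hT𝒯 hu₀T)
      filter_upwards [this] with u hu h1 h2 using hu ⟨h1, h2⟩
    · have hcl : IsClosed (convexHull ℝ (range T.points)) :=
        ((finite_range T.points).isCompact_convexHull ℝ).isClosed
      filter_upwards [hcl.isOpen_compl.mem_nhds hu₀T] with u hu _ h2 using absurd h2 hu
  have hall := (Filter.eventually_all_finset 𝒯).mpr hnear
  have hκ : Tendsto κ (𝓝 x) (𝓝 u₀) := κ.continuousAt hxκ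
  filter_upwards [hκ.eventually hall, κ.open_source.mem_nhds hxκ] with y hy hyκ
  obtain ⟨T, hT𝒯, hyT⟩ := mem_iUnion₂.mp (hcover (κ.map_source hyκ))
  have := hy T hT𝒯 (κ.map_source hyκ) hyT
  rwa [κ.left_inv hyκ] at this

end Atlas

end SingularFlat

/-! ### Extension of a distance from a dense set -/

/-- A distance on a dense set for which each point of the whole space has neighborhoods with traces
of arbitrarily small diameter extends continuously to the whole space. -/
theorem exists_continuous_extension_of_small {X : Type*} [TopologicalSpace X] {s : Set X}
    (hs : Dense s) {d : X → X → ℝ≥0∞}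
    (htri : ∀ x y z, d x z ≤ d x y + d y z)
    (hsmall : ∀ p, ∀ ε > (0 : ℝ), ∃ U ∈ 𝓝 p, ∀ x ∈ U, ∀ y ∈ U, x ∈ s → y ∈ s →
      d x y ≤ ENNReal.ofReal ε) :
    ∃ D : X × X → ℝ≥0∞, Continuous D ∧ ∀ x ∈ s, ∀ y ∈ s, D (x, y) = d x y := by
  set i : s × s → X × X := Prod.map Subtype.val Subtype.val with hi
  have hd : IsDenseInducing i :=
    IsDenseInducing.prodMap hs.isDenseInducing_val hs.isDenseInducing_val
  set f : s × s → ℝ≥0∞ := fun r => d r.1 r.2 with hf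
  have hlim : ∀ b, ∃ c, Tendsto f (comap i (𝓝 b)) (𝓝 c) := by
    rintro ⟨p, q⟩
    have hne : (comap i (𝓝 (p, q))).NeBot := hd.comap_nhds_neBot _
    have hosc : ∀ ε > (0 : ℝ), ∃ V ∈ comap i (𝓝 (p, q)), ∀ r ∈ V, ∀ r' ∈ V,
        f r ≤ f r' + ENNReal.ofReal ε := by
      intro ε hε
      obtain ⟨U, hU, hUd⟩ := hsmall p (ε / 2) (half_pos hε)
      obtain ⟨V, hV, hVd⟩ := hsmall q (ε / 2) (half_pos hε)
      refine ⟨_, preimage_mem_comap (prod_mem_nhds hU hV), ?_⟩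
      rintro ⟨x, y⟩ hr ⟨x', y'⟩ hr'
      have h1 := hUd x hr.1 x' hr'.1 x.2 x'.2
      have h2 := hVd y' hr'.2 y hr.2 y'.2 y.2
      calc d x y ≤ d x x' + d x' y := htri _ _ _
        _ ≤ d x x' + (d x' y' + d y' y) := by gcongr; exact htri _ _ _
        _ ≤ ENNReal.ofReal (ε / 2) + (d x' y' + ENNReal.ofReal (ε / 2)) := by gcongr
        _ = d x' y' + (ENNReal.ofReal (ε / 2) + ENNReal.ofReal (ε / 2)) := by ring
        _ = d x' y' + ENNReal.ofReal ε := by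
          rw [← ENNReal.ofReal_add (by positivity) (by positivity), add_halves]
    refine ⟨limsup f (comap i (𝓝 (p, q))), tendsto_of_le_liminf_of_limsup_le ?_ le_rfl⟩
    refine ENNReal.le_of_forall_pos_le_add fun ε hε _ => ?_
    obtain ⟨V, hV, hVf⟩ := hosc ε (by exact_mod_cast hε)
    rw [ENNReal.ofReal_coe_nnreal] at hVf
    rw [← tsub_le_iff_right]
    refine le_liminf_of_le (by isBoundedDefault) ?_
    filter_upwards [hV] with r' hr'
    rw [tsub_le_iff_right]
    refine limsup_le_of_le (by isBoundedDefault) ?_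
    filter_upwards [hV] with r hr using hVf r hr r' hr'
  refine ⟨hd.extend f, hd.continuous_extend hlim, fun x hx y hy => ?_⟩
  obtain ⟨c, hc⟩ := hlim (i (⟨x, hx⟩, ⟨y, hy⟩))
  have h1 : hd.extend f (x, y) = c := hd.extend_eq_of_tendsto hc
  -- the limit at a point of `s × s` is the value there
  have h2 : Tendsto f (pure (⟨x, hx⟩, ⟨y, hy⟩)) (𝓝 c) := by
    refine hc.mono_left ?_
    rw [← map_le_iff_le_comap, map_pure]
    exact pure_le_nhds _
  rw [h1]
  exact tendsto_nhds_unique h2 (tendsto_pure_nhds f _)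

/-- Points of the same component are at finite distance for a continuous distance that is
small near the diagonal of a dense set. -/
theorem ne_top_of_mem_connectedComponent {X : Type*} [TopologicalSpace X] {s : Set X}
    (hs : Dense s) {d : X → X → ℝ≥0∞} (htri : ∀ x y z, d x z ≤ d x y + d y z)
    (hsmall : ∀ p, ∀ ε > (0 : ℝ), ∃ U ∈ 𝓝 p, ∀ x ∈ U, ∀ y ∈ U, x ∈ s → y ∈ s →
      d x y ≤ ENNReal.ofReal ε) {D : X × X → ℝ≥0∞} (hD : Continuous D)
    (hDd : ∀ x ∈ s, ∀ y ∈ s, D (x, y) = d x y) {p q : X} (hq : q ∈ connectedComponent p) :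
    D (p, q) ≠ ⊤ := by
  have hss : Dense (s ×ˢ s) := hs.prod hs
  have htriD : ∀ x y z, D (x, z) ≤ D (x, y) + D (y, z) := by
    have hcl : IsClosed {r : X × X × X | D (r.1, r.2.2) ≤ D (r.1, r.2.1) + D (r.2.1, r.2.2)} :=
      isClosed_le (hD.comp (by fun_prop)) ((hD.comp (by fun_prop)).add (hD.comp (by fun_prop)))
    have hsub : s ×ˢ s ×ˢ s ⊆
        {r : X × X × X | D (r.1, r.2.2) ≤ D (r.1, r.2.1) + D (r.2.1, r.2.2)} := by
      rintro ⟨x, y, z⟩ ⟨hx, hy, hz⟩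
      simp only [mem_ofPred_eq]
      rw [hDd x hx z hz, hDd x hx y hy, hDd y hy z hz]
      exact htri _ _ _
    intro x y z
    exact closure_minimal hsub hcl (hs.prod hss (x, y, z))
  have hone : ∀ p, ∃ U ∈ 𝓝 p, ∀ x ∈ U, ∀ y ∈ U, D (x, y) ≤ 1 := by
    intro p
    obtain ⟨U, hU, hUd⟩ := hsmall p 1 one_pos
    rw [ENNReal.ofReal_one] at hUd
    refine ⟨interior U, interior_mem_nhds.mpr hU, fun x hx y hy => ?_⟩
    have h1 := hss.open_subset_closure_inter (isOpen_interior.prod isOpen_interior)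
      (show (x, y) ∈ interior U ×ˢ interior U from ⟨hx, hy⟩)
    refine closure_minimal (t := {r | D r ≤ 1}) ?_ (isClosed_le hD continuous_const) h1
    rintro ⟨x, y⟩ ⟨⟨hx, hy⟩, hxs, hys⟩
    simp only [mem_ofPred_eq]
    rw [hDd x hxs y hys]
    exact hUd x (interior_subset hx) y (interior_subset hy) hxs hys
  have hclopen : IsClopen {q | D (p, q) ≠ ⊤} := by
    constructor
    · refine isClosed_of_closure_subset fun q hq => ?_
      obtain ⟨U, hU, hU1⟩ := hone q
      obtain ⟨q', hq'U, hq'⟩ := mem_closure_iff_nhds.mp hq U hU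
      have := hU1 q' hq'U q (mem_of_mem_nhds hU)
      exact ((htriD p q' q).trans_lt (ENNReal.add_lt_top.mpr
        ⟨lt_top_iff_ne_top.mpr hq', this.trans_lt ENNReal.one_lt_top⟩)).ne
    · exact (isOpen_ne (x := (⊤ : ℝ≥0∞))).preimage (hD.comp (Continuous.prodMk_right p))
  refine hclopen.connectedComponent_subset ?_ hq
  obtain ⟨U, hU, hU1⟩ := hone p
  exact ((hU1 p (mem_of_mem_nhds hU) p (mem_of_mem_nhds hU)).trans_lt ENNReal.one_lt_top).ne

namespace SingularFlat

namespace Atlas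

variable {A : Set ℝ} {M : Type*} [TopologicalSpace M] {𝒜 : Atlas A M}

/-! ### Distance along curves -/

theorem IsPiecewiseSmoothSpacelike.eventually_nhdsWithin_regDist_le {S : Set M}
    (hS : 𝒜.IsPiecewiseSmoothSpacelike S) {x : M} (hxS : x ∈ S) (hx : x ∈ 𝒜.reg)
    {ψ : ℝ × OpenPartialHomeomorph M (ℝ × ℂ)} (hψ : ψ ∈ 𝒜.charts) (hxψ : x ∈ ψ.2.source) :
    ∀ᶠ y in 𝓝[S] x, 0 ≤ ds2 ψ.1 (ψ.2 x) (ψ.2 y - ψ.2 x) ∧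
      𝒜.regDist S x y ≤ ENNReal.ofReal (2 * √(ds2 ψ.1 (ψ.2 x) (ψ.2 y - ψ.2 x))) := by
  rw [nhdsWithin_eq_map_subtype_coe hxS]
  exact hS.eventually_regDist_le ⟨x, hxS⟩ hx hψ hxψ

/-- On the regular part, the distance is continuous for the topology of the surface. -/
theorem IsPiecewiseSmoothSpacelike.tendsto_regDist {S : Set M}
    (hS : 𝒜.IsPiecewiseSmoothSpacelike S) {x : M} (hxS : x ∈ S) (hx : x ∈ 𝒜.reg) :
    Tendsto (fun y => 𝒜.regDist S x y) (𝓝[S] x) (𝓝 0) := by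
  obtain ⟨ψ, hψ, hxψ⟩ := 𝒜.cover x
  have hreg := (mem_reg_iff hψ hxψ).mp hx
  have h0 : ds2 ψ.1 (ψ.2 x) 0 = 0 := by simpa using ds2_smul ψ.1 (ψ.2 x) 0 0
  have hc : ContinuousAt (fun y => ENNReal.ofReal
      (2 * √(ds2 ψ.1 (ψ.2 x) (ψ.2 y - ψ.2 x)))) x := by
    refine ENNReal.continuous_ofReal.continuousAt.comp ?_
    refine ContinuousAt.const_mul ?_ 2
    exact Real.continuous_sqrt.continuousAt.comp (continuousAt_ds2_comp continuousAt_const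
      ((ψ.2.continuousAt hxψ).sub continuousAt_const) hreg)
  have hlim : Tendsto (fun y => ENNReal.ofReal
      (2 * √(ds2 ψ.1 (ψ.2 x) (ψ.2 y - ψ.2 x)))) (𝓝[S] x) (𝓝 0) := by
    have := hc.tendsto.mono_left (nhdsWithin_le_nhds (s := S))
    simpa [h0] using this
  refine tendsto_of_tendsto_of_tendsto_of_le_of_le' tendsto_const_nhds hlim
    (Eventually.of_forall fun _ => zero_le) ?_
  filter_upwards [hS.eventually_nhdsWithin_regDist_le hxS hx hψ hxψ] with y hy using hy.2

theorem IsPiecewiseSmoothSpacelike.regDist_self {S : Set M}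
    (hS : 𝒜.IsPiecewiseSmoothSpacelike S) {x : M} (hxS : x ∈ S) (hx : x ∈ 𝒜.reg) :
    𝒜.regDist S x x = 0 :=
  tendsto_nhds_unique (tendsto_pure_nhds _ x)
    ((hS.tendsto_regDist hxS hx).mono_left (pure_le_nhdsWithin hxS))

/-- An infinitesimal bound of the distance along a continuous curve can be integrated. -/
theorem IsPiecewiseSmoothSpacelike.regDist_le_of_local {S : Set M}
    (hS : 𝒜.IsPiecewiseSmoothSpacelike S) {c : ℝ → M} {G : ℝ → ℝ} {a b : ℝ} (hab : a ≤ b)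
    (hc : ContinuousOn c (Icc a b)) (hcS : ∀ s ∈ Icc a b, c s ∈ S ∩ 𝒜.reg)
    (hG : ContinuousOn G (Icc a b))
    (hloc : ∀ s ∈ Ico a b, ∀ᶠ s' in 𝓝[>] s, G s ≤ G s' ∧
      𝒜.regDist S (c s) (c s') ≤ ENNReal.ofReal (G s' - G s)) :
    𝒜.regDist S (c a) (c b) ≤ ENNReal.ofReal (G b - G a) := by
  set T : Set ℝ := {s | G a ≤ G s ∧ 𝒜.regDist S (c a) (c s) ≤ ENNReal.ofReal (G s - G a)} with hT
  suffices b ∈ T from this.2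
  refine IsClosed.mem_of_ge_of_forall_exists_gt (a := a) ?_ ?_ hab ?_
  · refine isClosed_of_closure_subset fun s hs => ?_
    have hsI : s ∈ Icc a b := closure_minimal inter_subset_right isClosed_Icc hs
    rw [mem_closure_iff_nhdsWithin_neBot] at hs
    have hcs : Tendsto c (𝓝[T ∩ Icc a b] s) (𝓝[S] (c s)) := by
      refine tendsto_nhdsWithin_iff.mpr ⟨(hc s hsI).mono_left
        (nhdsWithin_mono _ inter_subset_right), ?_⟩
      filter_upwards [self_mem_nhdsWithin] with s' hs' using (hcS s' hs'.2).1
    have hGs : Tendsto G (𝓝[T ∩ Icc a b] s) (𝓝 (G s)) :=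
      (hG s hsI).mono_left (nhdsWithin_mono _ inter_subset_right)
    refine ⟨⟨ge_of_tendsto hGs ?_, ?_⟩, hsI⟩
    · filter_upwards [self_mem_nhdsWithin] with s' hs' using hs'.1.1
    · have h1 := (hS.tendsto_regDist (hcS s hsI).1 (hcS s hsI).2).comp hcs
      have h2 : Tendsto (fun s' => ENNReal.ofReal (G s' - G a) + 𝒜.regDist S (c s) (c s'))
          (𝓝[T ∩ Icc a b] s) (𝓝 (ENNReal.ofReal (G s - G a) + 0)) :=
        (ENNReal.tendsto_ofReal (hGs.sub_const _)).add h1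
      rw [add_zero] at h2
      refine ge_of_tendsto h2 ?_
      filter_upwards [self_mem_nhdsWithin] with s' hs'
      refine (regDist_triangle S (c a) (c s') (c s)).trans ?_
      rw [regDist_comm S (c s') (c s)]
      exact add_le_add_left hs'.1.2 _
  · refine ⟨le_rfl, ?_⟩
    have ha := hcS a ⟨le_rfl, hab⟩
    rw [hS.regDist_self ha.1 ha.2]
    exact zero_le
  · rintro s ⟨hs, hsI⟩
    have hmem : ∀ᶠ s' in 𝓝[>] s, s' ∈ Ioc s b := Ioc_mem_nhdsGT hsI.2
    obtain ⟨s', h1, h2⟩ := ((hloc s hsI).and hmem).exists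
    refine ⟨s', ⟨hs.1.trans h1.1, ?_⟩, h2⟩
    refine (regDist_triangle S (c a) (c s) (c s')).trans ((add_le_add hs.2 h1.2).trans ?_)
    rw [← ENNReal.ofReal_add (by linarith [hs.1]) (by linarith [h1.1])]
    exact ENNReal.ofReal_le_ofReal (by linarith)

end Atlas

/-! ### The distance near a singular point -/

/-- On a radial chord, the length is bounded by a quantity that is additive along the ray. In the
BTZ case, this is the inequality `2 √(a b) ≤ a + b`. -/
theorem sqrt_ds2_radial_le {α t τ r δ : ℝ} {e : ℂ} (he : ‖e‖ = 1) (hr : 0 < r) (hδ : 0 < δ)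
    (hpos : 0 ≤ ds2 α (t, r * e) (τ, δ * e)) :
    0 ≤ (if α = 0 then 2 * δ - 2 * τ else 2 * δ) ∧
      2 * √(ds2 α (t, r * e) (τ, δ * e)) ≤ if α = 0 then 2 * δ - 2 * τ else 2 * δ := by
  have he0 : e ≠ 0 := by rintro rfl; simp at he
  have hx : ((t, r * e) : ℝ × ℂ).2 ≠ 0 := mul_ne_zero (by exact_mod_cast hr.ne') he0
  have h1 : dr (t, r * e) (τ, δ * e) = δ := by rw [dr_mul_unit hr he]; simp
  have h2 : rdtheta (t, r * e) (τ, δ * e) = 0 := by rw [rdtheta_mul_unit hr he]; simp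
  split_ifs with hα
  · subst hα
    rw [ds2_zero_eq _ _ hx, h1, h2] at hpos ⊢
    simp only at hpos ⊢
    have h3 : 0 ≤ δ - 2 * τ := by
      by_contra h
      push Not at h
      nlinarith
    refine ⟨by linarith, ?_⟩
    rw [← le_div_iff₀' two_pos]
    refine Real.sqrt_le_iff.mpr ⟨by linarith, ?_⟩
    nlinarith [sq_nonneg τ]
  · rw [ds2_eq _ hα _ _ hx, h1, h2]
    refine ⟨by linarith, ?_⟩
    have : √(-(τ, δ * e).1 ^ 2 + δ ^ 2 + (α / (2 * Real.pi)) ^ 2 * 0 ^ 2) ≤ δ := by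
      refine Real.sqrt_le_iff.mpr ⟨hδ.le, ?_⟩
      simp only
      nlinarith [sq_nonneg τ]
    linarith

/-- On chords of a horizontal circle the metric is controlled by the Euclidean one. In the BTZ case
this needs the variation `τ` of the first coordinate to be small, because of the term `dτ dr`. -/
theorem ds2_circle_le {α t τ : ℝ} {z z' : ℂ} (hz : z ≠ 0) (hzz' : ‖z'‖ = ‖z‖) (hτ : |τ| ≤ ‖z‖) :
    ds2 α (t, z) (τ, z' - z) ≤ ((2 + |α|) * ‖z' - z‖) ^ 2 := by
  have hn : 0 < ‖z‖ := norm_pos_iff.mpr hz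
  unfold ds2
  split_ifs with hα
  · -- a chord of a circle makes an almost right angle with the radius
    have hdr : dr (t, z) (τ, z' - z) * (2 * ‖z‖) = -‖z' - z‖ ^ 2 := by
      have h1 : ‖z' - z‖ ^ 2 = ‖z'‖ ^ 2 + ‖z‖ ^ 2 - 2 * (starRingEnd ℂ z * z').re := by
        simp only [Complex.sq_norm, Complex.normSq_apply, Complex.mul_re, Complex.conj_re,
          Complex.conj_im, Complex.sub_re, Complex.sub_im]
        ring
      have h2 : (starRingEnd ℂ z * (z' - z)).re = (starRingEnd ℂ z * z').re - ‖z‖ ^ 2 := by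
        rw [mul_sub, Complex.sub_re, Complex.conj_mul', ← Complex.ofReal_pow, Complex.ofReal_re]
      unfold dr
      simp only [h2]
      rw [h1, hzz']
      field_simp
      ring
    have h3 : |-2 * τ * dr (t, z) (τ, z' - z)| ≤ ‖z' - z‖ ^ 2 := by
      have h4 : |dr (t, z) (τ, z' - z)| * (2 * ‖z‖) = ‖z' - z‖ ^ 2 := by
        rw [← abs_of_pos (show 0 < 2 * ‖z‖ by positivity), ← abs_mul, hdr, abs_neg,
          abs_of_nonneg (by positivity)]
      rw [← h4, abs_mul, abs_mul, abs_neg, abs_two]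
      nlinarith [abs_nonneg (dr (t, z) (τ, z' - z))]
    have h5 := (abs_le.mp h3).2
    simp only [hα, abs_zero, add_zero]
    nlinarith [sq_nonneg ‖z' - z‖]
  · have h1 : rdtheta (t, z) (τ, z' - z) ^ 2 ≤ ‖z' - z‖ ^ 2 := by
      have := abs_rdtheta_le (t, z) (τ, z' - z)
      exact sq_le_sq' (by linarith [(abs_le.mp this).1]) (abs_le.mp this).2
    have h2 : (α / (2 * Real.pi)) ^ 2 ≤ |α| ^ 2 := by
      rw [← sq_abs, abs_div, abs_of_pos (show 0 < 2 * Real.pi by positivity)]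
      have : 1 ≤ 2 * Real.pi := by linarith [Real.pi_gt_three]
      gcongr
      exact div_le_self (abs_nonneg α) this
    have h3 : (α / (2 * Real.pi)) ^ 2 * rdtheta (t, z) (τ, z' - z) ^ 2 ≤
        |α| ^ 2 * ‖z' - z‖ ^ 2 := by gcongr
    simp only
    nlinarith [sq_nonneg τ, sq_nonneg (rdtheta (t, z) (τ, z' - z)),
      mul_nonneg (abs_nonneg α) (sq_nonneg ‖z' - z‖), sq_nonneg ‖z' - z‖]

namespace Atlas

variable {A : Set ℝ} {M : Type*} [TopologicalSpace M] {𝒜 : Atlas A M}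

variable (𝒜) in
/-- In the chart `ψ`, the map `X` parametrizes a part of the surface `S` as the graph of `f` over
the disc of radius `ρ`, and this part is regular except at the center of the disc. -/
structure IsGraphParam (S : Set M) (ψ : ℝ × OpenPartialHomeomorph M (ℝ × ℂ)) (ρ : ℝ) (f : ℂ → ℝ)
    (X : ℂ → M) : Prop where
  mem_charts : ψ ∈ 𝒜.charts
  continuousOn_fun : ContinuousOn f (Metric.ball 0 ρ)
  continuousOn : ContinuousOn X (Metric.ball 0 ρ)
  mem : ∀ z ∈ Metric.ball (0 : ℂ) ρ, X z ∈ S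
  mem_source : ∀ z ∈ Metric.ball (0 : ℂ) ρ, X z ∈ ψ.2.source
  chart_eq : ∀ z ∈ Metric.ball (0 : ℂ) ρ, ψ.2 (X z) = (f z, z)
  reg : ∀ z ∈ Metric.ball (0 : ℂ) ρ, z ≠ 0 → X z ∈ 𝒜.reg

theorem IsCauchySurface.exists_isGraphParam [SecondCountableTopology M] {S : Set M}
    (hS : 𝒜.IsCauchySurface S) {p : M} (hp : p ∈ S) (hpreg : p ∉ 𝒜.reg) :
    ∃ ψ, ∀ η > 0, ∃ ρ > 0, ρ ≤ η ∧ ∃ f X, 𝒜.IsGraphParam S ψ ρ f X ∧ X 0 = p ∧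
      (∀ z ∈ Metric.ball (0 : ℂ) ρ, |f z - f 0| ≤ η) ∧
      ∀ᶠ y in 𝓝[S] p, y ∈ 𝒜.reg → ∃ z ∈ Metric.ball (0 : ℂ) ρ, z ≠ 0 ∧ X z = y := by
  obtain ⟨ψ, hψ, hpψ⟩ := 𝒜.cover p
  rw [mem_reg_iff hψ hpψ] at hpreg
  simp only [modelReg, mem_ofPred_eq, not_or, not_not] at hpreg
  obtain ⟨hp0, hα⟩ := hpreg
  set t₀ := (ψ.2 p).1 with ht₀
  have hpt : ψ.2 p = (t₀, 0) := Prod.ext rfl hp0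
  have hpt' : ψ.2.symm (t₀, 0) = p := by rw [← hpt, ψ.2.left_inv hpψ]
  obtain ⟨ε, hε, hball⟩ := Metric.isOpen_iff.mp ψ.2.open_target _ (ψ.2.map_source hpψ)
  rw [hpt] at hball
  refine ⟨ψ, fun η hη => ?_⟩
  have hε' : 0 < min ε η := lt_min hε hη
  have hball' := (Metric.ball_subset_ball (min_le_left ε η)).trans hball
  obtain ⟨ρ, hρ, hρε, f, hf, hfS, hfu⟩ :=
    hS.exists_continuous_graph hψ hp hpψ hpt hε' hball'
  have h0 : (0 : ℂ) ∈ Metric.ball (0 : ℂ) ρ := Metric.mem_ball_self hρ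
  have hf0 : f 0 = t₀ := (hfu 0 h0 t₀ (by simpa using ⟨hε, hη⟩) (by rwa [hpt'])).symm
  have htar : ∀ z ∈ Metric.ball (0 : ℂ) ρ, (f z, z) ∈ ψ.2.target := by
    intro z hz
    refine hball' (mem_ball_axis.mpr ⟨(hfS z hz).1, ?_⟩)
    exact (mem_ball_zero_iff.mp hz).trans_le hρε
  refine ⟨ρ, hρ, hρε.trans (min_le_right _ _), f, fun z => ψ.2.symm (f z, z),
    ⟨hψ, hf, ?_, fun z hz => (hfS z hz).2, fun z hz => ψ.2.map_target (htar z hz),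
      fun z hz => ψ.2.right_inv (htar z hz), fun z hz hz0 => ?_⟩, by simp only [hf0, hpt'], ?_, ?_⟩
  · exact ψ.2.continuousOn_symm.comp (hf.prodMk continuousOn_id) htar
  · rw [mem_reg_iff hψ (ψ.2.map_target (htar z hz)), ψ.2.right_inv (htar z hz)]
    exact Or.inl hz0
  · intro z hz
    rw [hf0]
    exact ((hfS z hz).1.trans_le (min_le_right _ _)).le
  · have h1 : Metric.ball t₀ (min ε η) ×ˢ Metric.ball (0 : ℂ) ρ ∈ 𝓝 (ψ.2 p) := by
      rw [hpt]
      exact prod_mem_nhds (Metric.ball_mem_nhds _ hε') (Metric.ball_mem_nhds _ hρ)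
    filter_upwards [nhdsWithin_le_nhds ((ψ.2.continuousAt hpψ) h1),
      nhdsWithin_le_nhds (ψ.2.open_source.mem_nhds hpψ), self_mem_nhdsWithin] with y hy hyψ hyS
      hyreg
    rw [mem_reg_iff hψ hyψ] at hyreg
    refine ⟨(ψ.2 y).2, hy.2, hyreg.resolve_right hα, ?_⟩
    have h2 := hfu (ψ.2 y).2 hy.2 (ψ.2 y).1 (by simpa [Real.dist_eq] using hy.1)
      (by rwa [Prod.mk.eta, ψ.2.left_inv hyψ])
    rw [← h2, Prod.mk.eta, ψ.2.left_inv hyψ]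

theorem IsGraphParam.eventually_regDist_le {S : Set M} (hS : 𝒜.IsPiecewiseSmoothSpacelike S)
    {ψ : ℝ × OpenPartialHomeomorph M (ℝ × ℂ)} {ρ : ℝ} {f : ℂ → ℝ} {X : ℂ → M}
    (h : 𝒜.IsGraphParam S ψ ρ f X) {z : ℂ} (hz : z ∈ Metric.ball (0 : ℂ) ρ) (hz0 : z ≠ 0) :
    ∀ᶠ z' in 𝓝 z, 0 ≤ ds2 ψ.1 (f z, z) (f z' - f z, z' - z) ∧
      𝒜.regDist S (X z) (X z') ≤
        ENNReal.ofReal (2 * √(ds2 ψ.1 (f z, z) (f z' - f z, z' - z))) := by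
  have hB : Metric.ball (0 : ℂ) ρ ∈ 𝓝 z := Metric.isOpen_ball.mem_nhds hz
  have hX : Tendsto X (𝓝 z) (𝓝[S] (X z)) := by
    refine tendsto_nhdsWithin_iff.mpr ⟨h.continuousOn.continuousAt hB, ?_⟩
    filter_upwards [hB] with z' hz' using h.mem z' hz'
  filter_upwards [hB, hX.eventually (hS.eventually_nhdsWithin_regDist_le (h.mem z hz) (h.reg z hz hz0)
    h.mem_charts (h.mem_source z hz))] with z' hz' hd
  rwa [h.chart_eq z hz, h.chart_eq z' hz', Prod.mk_sub_mk] at hd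

/-- Bound of the distance along a radius. -/
theorem IsGraphParam.regDist_radial_le {S : Set M} (hS : 𝒜.IsPiecewiseSmoothSpacelike S)
    {ψ : ℝ × OpenPartialHomeomorph M (ℝ × ℂ)} {ρ η : ℝ} {f : ℂ → ℝ} {X : ℂ → M}
    (h : 𝒜.IsGraphParam S ψ ρ f X) (hη : ∀ z ∈ Metric.ball (0 : ℂ) ρ, |f z - f 0| ≤ η) {e : ℂ}
    (he : ‖e‖ = 1) {a b : ℝ} (ha : 0 < a) (hab : a ≤ b) (hb : b < ρ) :
    𝒜.regDist S (X (a * e)) (X (b * e)) ≤ ENNReal.ofReal (2 * ρ + 4 * η) := by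
  have hnorm : ∀ s : ℝ, 0 < s → ‖(s : ℂ) * e‖ = s := fun s hs => by
    rw [norm_mul, he, mul_one, Complex.norm_real, Real.norm_of_nonneg hs.le]
  have hmem : ∀ s ∈ Icc a b, (s : ℂ) * e ∈ Metric.ball (0 : ℂ) ρ ∧ (s : ℂ) * e ≠ 0 := by
    intro s hs
    have hs0 : 0 < s := ha.trans_le hs.1
    have hn := hnorm s hs0
    refine ⟨by rw [mem_ball_zero_iff, hn]; exact hs.2.trans_lt hb, ?_⟩
    rw [← norm_pos_iff, hn]
    exact hs0
  have hcurve : Continuous fun s : ℝ => (s : ℂ) * e := by fun_prop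
  have hfc : ContinuousOn (fun s : ℝ => f (s * e)) (Icc a b) :=
    h.continuousOn_fun.comp hcurve.continuousOn fun s hs => (hmem s hs).1
  set G : ℝ → ℝ := fun s => if ψ.1 = 0 then 2 * s - 2 * f (s * e) else 2 * s with hG
  have hGdiff : ∀ s s', G s' - G s = if ψ.1 = 0 then 2 * (s' - s) - 2 * (f (s' * e) - f (s * e))
      else 2 * (s' - s) := by
    intro s s'
    simp only [hG]
    split_ifs <;> ring
  have key := hS.regDist_le_of_local (c := fun s : ℝ => X (s * e)) (G := G) hab
    (h.continuousOn.comp hcurve.continuousOn fun s hs => (hmem s hs).1)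
    (fun s hs => ⟨h.mem _ (hmem s hs).1, h.reg _ (hmem s hs).1 (hmem s hs).2⟩) ?_ ?_
  · refine key.trans (ENNReal.ofReal_le_ofReal ?_)
    have h1 := abs_le.mp (hη _ (hmem a ⟨le_rfl, hab⟩).1)
    have h2 := abs_le.mp (hη _ (hmem b ⟨hab, le_rfl⟩).1)
    rw [hGdiff]
    split_ifs <;> linarith
  · simp only [hG]
    split_ifs
    · exact (continuousOn_const.mul continuousOn_id).sub (continuousOn_const.mul hfc)
    · fun_prop
  · intro s hs
    have hsI : s ∈ Icc a b := ⟨hs.1, hs.2.le⟩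
    have h1 := (hcurve.tendsto s).mono_left (nhdsWithin_le_nhds (s := Ioi s))
    filter_upwards [h1.eventually (h.eventually_regDist_le hS (hmem s hsI).1 (hmem s hsI).2),
      self_mem_nhdsWithin] with s' hs' hss'
    have hδ : 0 < s' - s := sub_pos.mpr hss'
    rw [show (s' : ℂ) * e - s * e = ((s' - s : ℝ) : ℂ) * e by push_cast; ring] at hs'
    obtain ⟨h3, h4⟩ := sqrt_ds2_radial_le he (ha.trans_le hs.1) hδ hs'.1
    rw [← hGdiff s s'] at h3 h4
    exact ⟨by linarith, hs'.2.trans (ENNReal.ofReal_le_ofReal h4)⟩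

/-- Bound of the distance along a circle. -/
theorem IsGraphParam.regDist_circle_le {S : Set M} (hS : 𝒜.IsPiecewiseSmoothSpacelike S)
    {ψ : ℝ × OpenPartialHomeomorph M (ℝ × ℂ)} {ρ : ℝ} {f : ℂ → ℝ} {X : ℂ → M}
    (h : 𝒜.IsGraphParam S ψ ρ f X) {r : ℝ} (hr : 0 < r) (hrρ : r < ρ) {a b : ℝ} (hab : a ≤ b) :
    𝒜.regDist S (X (r * Complex.exp (Complex.I * a))) (X (r * Complex.exp (Complex.I * b))) ≤
      ENNReal.ofReal (2 * (2 + |ψ.1|) * r * (b - a)) := by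
  have hnorm : ∀ s : ℝ, ‖(r : ℂ) * Complex.exp (Complex.I * s)‖ = r := fun s => by
    rw [norm_mul, mul_comm Complex.I, Complex.norm_exp_ofReal_mul_I, mul_one, Complex.norm_real,
      Real.norm_of_nonneg hr.le]
  have hmem : ∀ s : ℝ, (r : ℂ) * Complex.exp (Complex.I * s) ∈ Metric.ball (0 : ℂ) ρ ∧
      (r : ℂ) * Complex.exp (Complex.I * s) ≠ 0 := by
    intro s
    refine ⟨by rwa [mem_ball_zero_iff, hnorm], ?_⟩
    rw [← norm_pos_iff, hnorm]
    exact hr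
  have hcurve : Continuous fun s : ℝ => (r : ℂ) * Complex.exp (Complex.I * s) := by fun_prop
  have hchord : ∀ s s' : ℝ, s < s' →
      ‖(r : ℂ) * Complex.exp (Complex.I * s') - r * Complex.exp (Complex.I * s)‖ ≤
        r * (s' - s) := by
    intro s s' hss'
    have h1 : (r : ℂ) * Complex.exp (Complex.I * s') - r * Complex.exp (Complex.I * s) =
        r * Complex.exp (Complex.I * s) * (Complex.exp (Complex.I * (s' - s : ℝ)) - 1) := by
      have : Complex.exp (Complex.I * s') =
          Complex.exp (Complex.I * s) * Complex.exp (Complex.I * (s' - s : ℝ)) := by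
        rw [← Complex.exp_add]; push_cast; ring_nf
      rw [this]; ring
    rw [h1, norm_mul, hnorm]
    gcongr
    refine Real.norm_exp_I_mul_ofReal_sub_one_le.trans ?_
    rw [Real.norm_of_nonneg (by linarith)]
  have key := hS.regDist_le_of_local
    (c := fun s : ℝ => X (r * Complex.exp (Complex.I * s)))
    (G := fun s => 2 * (2 + |ψ.1|) * r * s) hab
    (h.continuousOn.comp hcurve.continuousOn fun s _ => (hmem s).1)
    (fun s _ => ⟨h.mem _ (hmem s).1, h.reg _ (hmem s).1 (hmem s).2⟩) (by fun_prop) ?_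
  · simpa only [← mul_sub] using key
  · intro s _
    have h1 := (hcurve.tendsto s).mono_left (nhdsWithin_le_nhds (s := Ioi s))
    have hfc := h.continuousOn_fun.continuousAt (Metric.isOpen_ball.mem_nhds (hmem s).1)
    have hf := hfc.eventually (Metric.ball_mem_nhds _ hr)
    filter_upwards [h1.eventually (h.eventually_regDist_le hS (hmem s).1 (hmem s).2),
      h1.eventually hf, self_mem_nhdsWithin] with s' hs' hfs' hss'
    have hα := abs_nonneg ψ.1
    have hδ : 0 < s' - s := sub_pos.mpr hss'
    rw [Real.dist_eq] at hfs'
    have h2 := ds2_circle_le (α := ψ.1) (t := f (r * Complex.exp (Complex.I * s))) (hmem s).2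
      ((hnorm s').trans (hnorm s).symm) (by rw [hnorm s]; exact hfs'.le)
    have h3 := (Real.sqrt_le_sqrt h2).trans_eq (Real.sqrt_sq (by positivity))
    have h4 := mul_le_mul_of_nonneg_left (hchord s s' hss') (show 0 ≤ 2 + |ψ.1| by positivity)
    have h5 : 0 ≤ 2 * (2 + |ψ.1|) * r * (s' - s) := by positivity
    refine ⟨by linarith, hs'.2.trans (ENNReal.ofReal_le_ofReal ?_)⟩
    linarith

theorem IsGraphParam.regDist_le {S : Set M} (hS : 𝒜.IsPiecewiseSmoothSpacelike S)
    {ψ : ℝ × OpenPartialHomeomorph M (ℝ × ℂ)} {ρ η : ℝ} {f : ℂ → ℝ} {X : ℂ → M}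
    (h : 𝒜.IsGraphParam S ψ ρ f X) (hη : ∀ z ∈ Metric.ball (0 : ℂ) ρ, |f z - f 0| ≤ η)
    {z w : ℂ} (hz : z ∈ Metric.ball (0 : ℂ) ρ) (hw : w ∈ Metric.ball (0 : ℂ) ρ) (hz0 : z ≠ 0)
    (hw0 : w ≠ 0) :
    𝒜.regDist S (X z) (X w) ≤
      ENNReal.ofReal ((2 * ρ + 4 * η) + 2 * (2 + |ψ.1|) * ρ * (2 * Real.pi)) := by
  wlog hzw : ‖z‖ ≤ ‖w‖ generalizing z w
  · rw [regDist_comm]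
    exact this hw hz hw0 hz0 (not_le.mp hzw).le
  have hzn : 0 < ‖z‖ := norm_pos_iff.mpr hz0
  rw [mem_ball_zero_iff] at hz hw
  have hη0 : 0 ≤ η := (abs_nonneg _).trans (hη 0 (Metric.mem_ball_self (hzn.trans hz)))
  have hα := abs_nonneg ψ.1
  have hpolar : ∀ u : ℂ, (‖u‖ : ℂ) * Complex.exp (Complex.I * u.arg) = u := fun u => by
    rw [mul_comm Complex.I, Complex.norm_mul_exp_arg_mul_I]
  -- along the radius of `w` from radius `‖w‖` to radius `‖z‖`, then along the circle through `z`
  have h1 := h.regDist_radial_le hS hη (e := Complex.exp (Complex.I * w.arg))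
    (by rw [mul_comm Complex.I, Complex.norm_exp_ofReal_mul_I]) hzn hzw hw
  rw [hpolar w] at h1
  have h2 : 𝒜.regDist S (X z) (X (‖z‖ * Complex.exp (Complex.I * w.arg))) ≤
      ENNReal.ofReal (2 * (2 + |ψ.1|) * ρ * (2 * Real.pi)) := by
    have harg : ∀ {a b : ℝ}, |a| ≤ Real.pi → |b| ≤ Real.pi → a ≤ b →
        2 * (2 + |ψ.1|) * ‖z‖ * (b - a) ≤ 2 * (2 + |ψ.1|) * ρ * (2 * Real.pi) := by
      intro a b ha hb hab
      have h3 : b - a ≤ 2 * Real.pi := by linarith [(abs_le.mp ha).1, (abs_le.mp hb).2]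
      have h4 : 0 ≤ b - a := by linarith
      have h5 : 0 ≤ ρ := hzn.le.trans hz.le
      gcongr
    have hzw' := Complex.abs_arg_le_pi
    rcases le_total z.arg w.arg with hle | hle
    · have := h.regDist_circle_le hS hzn hz hle
      rw [hpolar z] at this
      exact this.trans (ENNReal.ofReal_le_ofReal (harg (hzw' z) (hzw' w) hle))
    · have := h.regDist_circle_le hS hzn hz hle
      rw [hpolar z, regDist_comm] at this
      exact this.trans (ENNReal.ofReal_le_ofReal (harg (hzw' w) (hzw' z) hle))
  refine (regDist_triangle S _ _ _).trans ((add_le_add h2 h1).trans ?_)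
  have hρ : 0 < ρ := hzn.trans hz
  rw [← ENNReal.ofReal_add (by positivity) (by positivity), add_comm]

/-- Small neighborhoods of a point of the surface, regular or not, have small regular part. -/
theorem exists_nhdsWithin_regDist_le [SecondCountableTopology M] {S : Set M}
    (hS : 𝒜.IsCauchySurface S) (hS' : 𝒜.IsPiecewiseSmoothSpacelike S) {p : M} (hp : p ∈ S)
    {ε : ℝ} (hε : 0 < ε) :
    ∃ U ∈ 𝓝[S] p, ∀ x ∈ U, ∀ y ∈ U, x ∈ 𝒜.reg → y ∈ 𝒜.reg →
      𝒜.regDist S x y ≤ ENNReal.ofReal ε := by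
  by_cases hreg : p ∈ 𝒜.reg
  · have h1 := (hS'.tendsto_regDist hp hreg).eventually
      (ge_mem_nhds (show 0 < ENNReal.ofReal (ε / 2) by simpa using hε))
    refine ⟨_, h1, fun x hx y hy _ _ => ?_⟩
    refine (regDist_triangle S x p y).trans ?_
    rw [regDist_comm S x p]
    refine (add_le_add hx hy).trans ?_
    rw [← ENNReal.ofReal_add (by positivity) (by positivity), add_halves]
  · obtain ⟨ψ, hψ⟩ := hS.exists_isGraphParam hp hreg
    set B := 6 + 2 * (2 + |ψ.1|) * (2 * Real.pi) with hB
    have hα := abs_nonneg ψ.1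
    have hB0 : 0 < B := by positivity
    obtain ⟨ρ, hρ, hρη, f, X, hX, -, hf, hev⟩ := hψ (ε / B) (by positivity)
    refine ⟨_, hev, fun x hx y hy hxr hyr => ?_⟩
    obtain ⟨z, hz, hz0, rfl⟩ := hx hxr
    obtain ⟨w, hw, hw0, rfl⟩ := hy hyr
    refine (hX.regDist_le hS' hf hz hw hz0 hw0).trans (ENNReal.ofReal_le_ofReal ?_)
    calc (2 * ρ + 4 * (ε / B)) + 2 * (2 + |ψ.1|) * ρ * (2 * Real.pi)
        ≤ (2 * (ε / B) + 4 * (ε / B)) + 2 * (2 + |ψ.1|) * (ε / B) * (2 * Real.pi) := by gcongr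
      _ = ε / B * B := by rw [hB]; ring
      _ = ε := by field_simp

/-- In the graph around a singular point, only the center of the disc is singular. -/
theorem IsCauchySurface.dense_reg [SecondCountableTopology M] {S : Set M}
    (hS : 𝒜.IsCauchySurface S) : Dense {x : S | (x : M) ∈ 𝒜.reg} := by
  intro p
  by_cases hreg : (p : M) ∈ 𝒜.reg
  · exact subset_closure hreg
  rw [closure_subtype]
  obtain ⟨ψ, hψ⟩ := hS.exists_isGraphParam p.2 hreg
  obtain ⟨ρ, hρ, -, f, X, hX, hX0, -, -⟩ := hψ 1 one_pos
  have hB := Metric.ball_mem_nhds (0 : ℂ) hρ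
  have h1 : Tendsto X (𝓝[≠] 0) (𝓝 p) := by
    rw [← hX0]
    exact (hX.continuousOn.continuousAt hB).tendsto.mono_left nhdsWithin_le_nhds
  refine mem_closure_of_tendsto h1 ?_
  filter_upwards [self_mem_nhdsWithin, nhdsWithin_le_nhds hB] with z hz0 hz
  exact ⟨⟨X z, hX.mem z hz⟩, hX.reg z hz hz0, rfl⟩

end Atlas

end SingularFlat

theorem mainTheorem7 {A : Set ℝ} (hA : ∀ α ∈ A, 0 ≤ α)
    {M : Type*} [TopologicalSpace M] [T2Space M] [SecondCountableTopology M]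
    (𝒜 : SingularFlat.Atlas A M) (S : Set M)
    (hS : 𝒜.IsCauchySurface S) (hS' : 𝒜.IsPiecewiseSmoothSpacelike S) :
    ∃ D : S × S → ℝ≥0∞,
      Continuous D ∧
      (∀ x y : S, (x : M) ∈ 𝒜.reg → (y : M) ∈ 𝒜.reg → D (x, y) = 𝒜.regDist S x y) ∧
      (∀ D' : S × S → ℝ≥0∞, Continuous D' →
        (∀ x y : S, (x : M) ∈ 𝒜.reg → (y : M) ∈ 𝒜.reg → D' (x, y) = 𝒜.regDist S x y) →
        D' = D) ∧
      (∀ p q : S, q ∈ connectedComponent p → D (p, q) ≠ ⊤) := by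
  have hdense := hS.dense_reg
  have htri : ∀ x y z : S, 𝒜.regDist S x z ≤ 𝒜.regDist S x y + 𝒜.regDist S y z :=
    fun x y z => SingularFlat.Atlas.regDist_triangle S x y z
  have hsmall : ∀ p : S, ∀ ε > (0 : ℝ), ∃ U ∈ 𝓝 p, ∀ x ∈ U, ∀ y ∈ U,
      x ∈ {x : S | (x : M) ∈ 𝒜.reg} → y ∈ {x : S | (x : M) ∈ 𝒜.reg} →
      𝒜.regDist S x y ≤ ENNReal.ofReal ε := by
    intro p ε hε
    obtain ⟨U, hU, hUd⟩ := SingularFlat.Atlas.exists_nhdsWithin_regDist_le hS hS' p.2 hε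
    refine ⟨Subtype.val ⁻¹' U, ?_, fun x hx y hy => hUd x hx y hy⟩
    rw [nhdsWithin_eq_map_subtype_coe p.2] at hU
    exact hU
  obtain ⟨D, hD, hDd⟩ := exists_continuous_extension_of_small hdense htri hsmall
  refine ⟨D, hD, fun x y hx hy => hDd x hx y hy, fun D' hD' hDd' => ?_, fun p q hq =>
    ne_top_of_mem_connectedComponent hdense htri hsmall hD hDd hq⟩
  refine Continuous.ext_on (hdense.prod hdense) hD' hD ?_
  rintro ⟨x, y⟩ ⟨hx, hy⟩
  rw [hDd' x y hx hy, hDd x hx y hy]
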